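/- Let $C(\cdot)$ and $C(\cdot|\cdot)$ denote plain and conditional Kolmogorov complexity with respect to a fixed optimal description method, let $I(a:b)=C(b)-C(b|a)$ and $I(a:b|e)=C(b|e)-C(b|a,e)$. For $n\ge 1$ let $\mathbb F_{2^n}$ be the field with $2^n$ elements, its elements being represented by the binary strings of length $n$ in such a way that addition and multiplication are computable uniformly in $n$. For $d,m\ge 0$ consider the bipartite graph with left vertices $\bar x=\langle x,r_x\rangle$, where $x=(x_1,x_2)\in\mathbb F_{2^n}^2$ and $r_x\in\{0,1\}^m$, and right vertices $\bar y=\langle y,r_y\rangle$, where $y=(s_0,\dots,s_d)\in\mathbb F_{2^n}^{d+1}$ is (the coefficient tuple of) a polynomial of degree at most $d$ and $r_y\in\{0,1\}^m$; $\bar x$ and $\bar y$ are joined by an edge iff $x_2=s_0+s_1x_1+\dots+s_dx_1^d$. Fix a computable two-party communication protocol, in which Alice is given $\bar x$ (so $r_x$ serves as her private randomness), Bob is given $\bar y$, and both know $n,d,m$. They write bits on a public channel; the bits written so far determine who writes the next bit or that the communication is over. At the end each party computes a key from her or his own input and the transcript $t$. Then for every constant $c$ there is a constant $c'$ (depending only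 on $c$, the protocol, the description method and the representation of the fields) such that the following holds for all $n\ge1$, $d,m\ge 0$ and all $N\ge (2n+m)+((d+1)n+m)$ (the total length of the inputs). Let $(\bar x,\bar y)$ be a typical edge, i.e. an edge for which $$C(\bar x)=2n+m,\qquad C(\bar y)=(d+1)n+m,\qquad C(\bar x,\bar y)=(d+2)n+2m,$$ each up to an additive error of at most $c\lfloor\log_2 N\rfloor$. Suppose that on the inputs $\bar x,\bar y$ the protocol halts with the transcript $t$, and that both parties obtain the same key $z$, which has the maximal complexity, $C(z)\ge I(\bar x:\bar y)-c\lfloor\log_2 N\rfloor$, and is secret, $I(z:t)\le c\lfloor\log_2N\rfloor$. Then $C(x|y)=n$ and $C(y|x)=dn$ up to an additive error of at most $c'\lfloor\log_2N\rfloor$, and at least one of the following holds: 1. Alice reveals, and sends, all the information on $x$ that Bob lacks: $I(\bar x:t|\bar y)\ge C(x|y)-c'\lfloor\log_2N\rfloor$, and the number of bits of $t$ written by Alice is at least $C(x|y)-c'\lfloor\log_2N\rfloor$; 2. Bob reveals, and sends, all the information on $y$ that Alice lacks: $I(\bar y:t|\bar x)\ge C(y|x)-c'\lfloor\log_2N\rfloor$,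 and the number of bits of $t$ written by Bob is at least $C(y|x)-c'\lfloor\log_2N\rfloor$. -/

import Mathlib

/-! ### Kolmogorov complexity -/

/-- Finite binary strings. -/
abbrev Str : Type := List Bool

/-- A description method (decompressor) maps a program, which is a binary string, and a condition to
an output, if it halts; conditions and outputs are finite objects given by their standard codes. -/
abbrev DescriptionMethod : Type := Str → ℕ →. ℕ

/-- `U` is an optimal description method: it is partial computable, and it is at least as good as
every other partial computable description method, up to an additive constant. -/
def IsOptimal (U : DescriptionMethod) : Prop :=
  Partrec₂ U ∧ ∀ V : DescriptionMethod, Partrec₂ V →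
    ∃ c : ℕ, ∀ (p : Str) (a b : ℕ), a ∈ V p b → ∃ q : Str, a ∈ U q b ∧ q.length ≤ p.length + c

/-- Conditional (plain) Kolmogorov complexity `C(a | b)` of finite objects. Several objects are
conditioned on, or described, jointly by taking tuples. -/
noncomputable def condC (U : DescriptionMethod) {α β : Type} [Primcodable α] [Primcodable β]
    (a : α) (b : β) : ℕ :=
  sInf {l : ℕ | ∃ p : Str, Encodable.encode a ∈ U p (Encodable.encode b) ∧ p.length = l}

/-- Kolmogorov complexity `C(a)`. -/
noncomputable def plainC (U : DescriptionMethod) {α : Type} [Primcodable α] (a : α) : ℕ :=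
  condC U a ()

/-- `I(a : b) = C(b) - C(b | a)`, the information in `a` on `b`. -/
noncomputable def mutInfo (U : DescriptionMethod) {α β : Type} [Primcodable α] [Primcodable β]
    (a : α) (b : β) : ℤ :=
  (plainC U b : ℤ) - condC U b a

/-- `I(a : b | e) = C(b | e) - C(b | a, e)`, the information in `a` on `b` conditional on `e`. -/
noncomputable def condMutInfo (U : DescriptionMethod) {α β γ : Type} [Primcodable α]
    [Primcodable β] [Primcodable γ] (a : α) (b : β) (e : γ) : ℤ :=
  (condC U b e : ℤ) - condC U b (a, e)

/-! ### The graph of points and polynomials, with private randomness -/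

/-- The point `x` lies on the graph of the polynomial `s 0 + s 1 * T + ... + s d * T ^ d`. -/
def Incident {F : Type} [Field F] {d : ℕ} (x : F × F) (s : Fin (d + 1) → F) : Prop :=
  x.2 = ∑ i : Fin (d + 1), s i * x.1 ^ (i : ℕ)

/-- The edges of the `m`-private randomness amplification of the bipartite graph with edges `E`. -/
def AmplifiedEdge {L R : Type} (E : L → R → Prop) (m : ℕ)
    (x : L × (Fin m → Bool)) (y : R × (Fin m → Bool)) : Prop :=
  E x.1 y.1

/-- An explicit representation of the fields with `2 ^ n` elements, `n ≥ 1`, by the strings of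
length `n`: the field operations are computable, uniformly in `n`. -/
structure FieldCoding where
  enc : (n : ℕ) → GaloisField 2 n → Str
  enc_injective : ∀ n, Function.Injective (enc n)
  enc_length : ∀ n, 1 ≤ n → ∀ a, (enc n a).length = n
  add_computable : ∃ f : ℕ → Str × Str → Str, Computable₂ f ∧
    ∀ n, 1 ≤ n → ∀ a b, f n (enc n a, enc n b) = enc n (a + b)
  mul_computable : ∃ f : ℕ → Str × Str → Str, Computable₂ f ∧
    ∀ n, 1 ≤ n → ∀ a b, f n (enc n a, enc n b) = enc n (a * b)

/-- Points of the plane over the field with `2 ^ n` elements. -/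
abbrev Point (n : ℕ) : Type := GaloisField 2 n × GaloisField 2 n

/-- Polynomials of degree at most `d` over the field with `2 ^ n` elements. -/
abbrev PolyUpTo (n d : ℕ) : Type := Fin (d + 1) → GaloisField 2 n

namespace FieldCoding

/-- The code of a point: its two coordinates. -/
def point (K : FieldCoding) {n : ℕ} (x : Point n) : Str × Str :=
  (K.enc n x.1, K.enc n x.2)

/-- The code of a polynomial: the list of its `d + 1` coefficients. -/
def poly (K : FieldCoding) {n d : ℕ} (y : PolyUpTo n d) : List Str :=
  List.ofFn fun i => K.enc n (y i)

/-- The input of Alice: a point and her private random bits. -/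
def left (K : FieldCoding) {n m : ℕ} (x : Point n × (Fin m → Bool)) : (Str × Str) × Str :=
  (K.point x.1, List.ofFn x.2)

/-- The input of Bob: a polynomial and his private random bits. -/
def right (K : FieldCoding) {n d m : ℕ} (y : PolyUpTo n d × (Fin m → Bool)) : List Str × Str :=
  (K.poly y.1, List.ofFn y.2)

end FieldCoding

/-- `(x, y)` is a typical edge of the amplified graph, up to the error term `ε`. -/
def IsTypicalEdge (U : DescriptionMethod) (K : FieldCoding) {n d m : ℕ} (ε : ℤ)
    (x : Point n × (Fin m → Bool)) (y : PolyUpTo n d × (Fin m → Bool)) : Prop :=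
  AmplifiedEdge Incident m x y ∧
  |(plainC U (K.left x) : ℤ) - (2 * n + m)| ≤ ε ∧
  |(plainC U (K.right y) : ℤ) - ((d + 1) * n + m)| ≤ ε ∧
  |(plainC U (K.left x, K.right y) : ℤ) - ((d + 2) * n + 2 * m)| ≤ ε

/-! ### Communication protocols -/

/-- The public parameters `n`, `d`, `m`. -/
abbrev Params : Type := ℕ × ℕ × ℕ

/-- A computable two-party protocol for key agreement. The parties write bits on a public channel.
The bits written so far (and the public parameters) determine who writes the next bit
(`some true` for Alice, `some false` for Bob), or that the communication is over (`none`).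
The value of the bit depends also on the input, including the private random bits, of the party that
writes it. In the end each party computes a key from her or his input and the transcript. -/
structure KeyProtocol where
  speaker : Params → Str → Option Bool
  aliceBit : Params → ((Str × Str) × Str) × Str → Bool
  bobBit : Params → (List Str × Str) × Str → Bool
  aliceKey : Params → ((Str × Str) × Str) × Str → Str
  bobKey : Params → (List Str × Str) × Str → Str
  speaker_computable : Computable₂ speaker
  aliceBit_computable : Computable₂ aliceBit
  bobBit_computable : Computable₂ bobBit
  aliceKey_computable : Computable₂ aliceKey
  bobKey_computable : Computable₂ bobKey

namespace KeyProtocol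

/-- On the inputs `a` of Alice and `b` of Bob, the protocol halts with the transcript `t`. -/
def IsTranscript (P : KeyProtocol) (π : Params) (a : (Str × Str) × Str) (b : List Str × Str)
    (t : Str) : Prop :=
  P.speaker π t = none ∧
  ∀ i : Fin t.length,
    (P.speaker π (t.take i) = some true ∧ t.get i = P.aliceBit π (a, t.take i)) ∨
    (P.speaker π (t.take i) = some false ∧ t.get i = P.bobBit π (b, t.take i))

/-- On the inputs `a` and `b`, the protocol halts with the transcript `t`, and both parties
obtain the key `z`. -/
def AgreesOn (P : KeyProtocol) (π : Params) (a : (Str × Str) × Str) (b : List Str × Str)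
    (t z : Str) : Prop :=
  P.IsTranscript π a b t ∧ P.aliceKey π (a, t) = z ∧ P.bobKey π (b, t) = z

/-- The number of bits of the transcript `t` written by Alice (`who = true`) or by Bob
(`who = false`). -/
def bitsSent (P : KeyProtocol) (π : Params) (who : Bool) (t : Str) : ℕ :=
  (Finset.univ.filter fun i : Fin t.length => P.speaker π (t.take i) = some who).card

end KeyProtocol

/-! Write a, b for the two inputs and ignore terms logarithmic in N. The pairs of inputs that
produce a given transcript form a rectangle, and the rectangles of distinct transcripts are
disjoint. Counting gives C(t) + C(a|t) + C(b|t) ≤ C(a) + C(b) (`IsOptimal.plainC_transcript_le`).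
The key is computed from (a,t) and also from (b,t), so symmetry of information
(`IsOptimal.plainC_add_condC_le`) gives C(z,t) + C(a|z,t) ≤ C(t) + C(a|t), and the same for b.
Adding up, C(a|z,t) + C(b|z,t) - C(a,b|z,t) ≤ I(a:b) - C(z|t). For a secret key of maximal
complexity the right side vanishes: given z and t, the inputs are independent.

The graph, however, is mixing. Two distinct polynomials share at most d points, so by Cauchy-Schwarz
(`card_edges_sq_le`) sets S, T of vertices span at most about (2^m |S| |T| max(|S|,|T|))^(1/2)
edges. For the vertices no more complex than a, respectively b, given (z,t), this reads 2C(a,b|z,t)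
≤ m + C(a|z,t) + C(b|z,t) + max(C(a|z,t), C(b|z,t)) (`IsOptimal.condC_edge_le`). With independence,
the smaller of C(a|z,t) and C(b|z,t) is at most m.

Suppose it is C(a|z,t). Given t, Bob can compute z, so n + m = C(a|b) ≤ C(t|b) + C(a|z,t), whence
C(t|b) ≥ n. Since t is a function of (a,b), this is information revealed by a; since t is determined
by b and Alice's bits, she has sent at least n of them. The other case is symmetric, with dn in
place of n.

Inequalities between complexities come from counting: at most 2^(k+1) objects have complexity at
most k, and conversely an element of an enumerable set of size at most 2^k has complexity at most k
+ O(l) when the enumeration needs O(l) bits of parameters (`IsOptimal.condC_le_add_mul`). Here l is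
of order log N. -/

open Encodable

/-! ### Computability of functions on tuples -/

attribute [fun_prop] Computable
attribute [fun_prop] Computable.id Computable.const Computable.comp Computable.pair

section Computable

variable {α β γ σ : Type} [Primcodable α] [Primcodable β] [Primcodable γ] [Primcodable σ]

@[fun_prop]
theorem Computable.fst_comp {f : α → β × γ} (hf : Computable f) : Computable fun a => (f a).1 :=
  Computable.fst.comp hf

@[fun_prop]
theorem Computable.snd_comp {f : α → β × γ} (hf : Computable f) : Computable fun a => (f a).2 :=
  Computable.snd.comp hf

@[fun_prop]
theorem Computable.take_comp {f : α → List β} {g : α → ℕ} (hf : Computable f) (hg : Computable g) :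
    Computable fun a => (f a).take (g a) :=
  (Primrec.list_take.to_comp).comp hg hf

@[fun_prop]
theorem Computable.append_comp {f g : α → List β} (hf : Computable f) (hg : Computable g) :
    Computable fun a => f a ++ g a :=
  Computable.list_append.comp hf hg

@[fun_prop]
theorem Computable.cons_comp {f : α → β} {g : α → List β} (hf : Computable f) (hg : Computable g) :
    Computable fun a => f a :: g a :=
  Computable.list_cons.comp hf hg

@[fun_prop]
theorem Computable.length_comp {f : α → List β} (hf : Computable f) :
    Computable fun a => (f a).length :=
  Computable.list_length.comp hf

@[fun_prop]
theorem Computable.getElem?_comp {f : α → List β} {g : α → ℕ} (hf : Computable f)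
    (hg : Computable g) : Computable fun a => (f a)[g a]? :=
  Computable.list_getElem?.comp hf hg

@[fun_prop]
theorem Computable.getD_comp {f : α → List β} {g : α → ℕ} (d : β) (hf : Computable f)
    (hg : Computable g) : Computable fun a => (f a).getD (g a) d :=
  ((Primrec.list_getD d).to_comp).comp hf hg

@[fun_prop]
theorem Computable.some_comp {f : α → β} (hf : Computable f) :
    Computable fun a => some (f a) :=
  Computable.option_some.comp hf

@[fun_prop]
theorem Computable.add_comp {f g : α → ℕ} (hf : Computable f) (hg : Computable g) :
    Computable fun a => f a + g a :=
  (Primrec.nat_add.to_comp).comp hf hg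

@[fun_prop]
theorem Computable.sub_comp {f g : α → ℕ} (hf : Computable f) (hg : Computable g) :
    Computable fun a => f a - g a :=
  (Primrec.nat_sub.to_comp).comp hf hg

@[fun_prop]
theorem Computable.pow_comp {f g : α → ℕ} (hf : Computable f) (hg : Computable g) :
    Computable fun a => f a ^ g a := by
  have h : Primrec₂ ((· ^ ·) : ℕ → ℕ → ℕ) := Primrec₂.unpaired'.1 Nat.Primrec.pow
  exact h.to_comp.comp hf hg

end Computable

/-! ### Semidecidable predicates -/

/-- `p` is semidecidable: it holds at `a` iff some natural number witnesses it, where witnesses are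
recognized by a primitive recursive test. -/
def Semi {α : Type} [Primcodable α] (p : α → Prop) : Prop :=
  ∃ D : α → ℕ → Bool, Primrec₂ D ∧ ∀ a, p a ↔ ∃ w, D a w = true

namespace Semi

variable {α β γ σ : Type} [Primcodable α] [Primcodable β] [Primcodable γ] [Primcodable σ]

theorem of_iff {p q : α → Prop} (hp : Semi p) (h : ∀ a, q a ↔ p a) : Semi q := by
  obtain ⟨D, hD, H⟩ := hp
  exact ⟨D, hD, fun a => (h a).trans (H a)⟩

theorem and {p q : α → Prop} (hp : Semi p) (hq : Semi q) : Semi fun a => p a ∧ q a := by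
  obtain ⟨D, hD, H⟩ := hp
  obtain ⟨D', hD', H'⟩ := hq
  refine ⟨fun a w => D a w.unpair.1 && D' a w.unpair.2, ?_, fun a => ?_⟩
  · have h1 : Primrec fun x : α × ℕ => x.2.unpair := Primrec.unpair.comp Primrec.snd
    exact (Primrec.dom_bool₂ (· && ·)).comp (hD.comp Primrec.fst (Primrec.fst.comp h1))
      (hD'.comp Primrec.fst (Primrec.snd.comp h1))
  · beta_reduce
    rw [H, H']
    constructor
    · rintro ⟨⟨w, hw⟩, w', hw'⟩
      exact ⟨Nat.pair w w', by simp [hw, hw']⟩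
    · rintro ⟨w, hw⟩
      simp only [Bool.and_eq_true] at hw
      exact ⟨⟨_, hw.1⟩, _, hw.2⟩

theorem or {p q : α → Prop} (hp : Semi p) (hq : Semi q) : Semi fun a => p a ∨ q a := by
  obtain ⟨D, hD, H⟩ := hp
  obtain ⟨D', hD', H'⟩ := hq
  refine ⟨fun a w => D a w || D' a w, ?_, fun a => ?_⟩
  · exact (Primrec.dom_bool₂ (· || ·)).comp hD hD'
  · simp [H, H', exists_or]

theorem ex {p : α → γ → Prop} (hp : Semi fun x : α × γ => p x.1 x.2) :
    Semi fun a => ∃ c, p a c := by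
  obtain ⟨D, hD, H⟩ := hp
  refine ⟨fun a w => Option.casesOn (motive := fun _ => Bool) (decode (α := γ) w.unpair.1) false
    fun c => D (a, c) w.unpair.2, ?_, fun a => ?_⟩
  · have h1 : Primrec fun x : α × ℕ => x.2.unpair := Primrec.unpair.comp Primrec.snd
    refine Primrec.option_casesOn (Primrec.decode.comp (Primrec.fst.comp h1)) (Primrec.const _) ?_
    exact hD.comp (Primrec.pair (Primrec.fst.comp Primrec.fst) Primrec.snd)
      (Primrec.snd.comp (h1.comp Primrec.fst))
  · constructor
    · rintro ⟨c, hc⟩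
      obtain ⟨w, hw⟩ := (H (a, c)).1 hc
      exact ⟨Nat.pair (encode c) w, by simp [hw]⟩
    · rintro ⟨w, hw⟩
      rcases h : decode (α := γ) w.unpair.1 with _ | c
      · simp [h] at hw
      · simp only [h] at hw
        exact ⟨c, (H (a, c)).2 ⟨_, hw⟩⟩

theorem of_partrec {f : α →. σ} (hf : Partrec f) : Semi fun x : α × σ => x.2 ∈ f x.1 := by
  obtain ⟨c, hc⟩ := Nat.Partrec.Code.exists_code.1 hf
  refine ⟨fun x w => decide (Nat.Partrec.Code.evaln w c (encode x.1) = some (encode x.2)), ?_,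
    fun x => ?_⟩
  · have h1 : Primrec fun x : (α × σ) × ℕ =>
        Nat.Partrec.Code.evaln x.2 c (encode x.1.1) :=
      Nat.Partrec.Code.primrec_evaln.comp ((Primrec.snd.pair (Primrec.const c)).pair
        (Primrec.encode.comp (Primrec.fst.comp Primrec.fst)))
    have h2 : Primrec fun x : (α × σ) × ℕ => some (encode x.1.2) :=
      Primrec.option_some.comp (Primrec.encode.comp (Primrec.snd.comp Primrec.fst))
    exact primrecPred_iff_primrec_decide.1 (Primrec.eq.comp h1 h2)
  · have : x.2 ∈ f x.1 ↔ encode x.2 ∈ Nat.Partrec.Code.eval c (encode x.1) := by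
      rw [hc]
      simp [encodek]
    refine this.trans (Nat.Partrec.Code.evaln_complete.trans ?_)
    simp

/-- The test has to stay primitive recursive although `f` is only computable. Hence the value of `f`
is guessed as part of the witness and checked through the semidecidable graph of `f`. -/
theorem comp {p : β → Prop} (hp : Semi p) {f : α → β} (hf : Computable f) :
    Semi fun a => p (f a) := by
  have h1 : Semi fun x : α × β => x.2 = f x.1 := by
    simpa using of_partrec hf
  have h2 : Semi fun x : α × β => p x.2 := by
    obtain ⟨D, hD, H⟩ := hp
    exact ⟨fun x w => D x.2 w, hD.comp (Primrec.snd.comp Primrec.fst) Primrec.snd,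
      fun x => H x.2⟩
  exact (Semi.ex (p := fun a b => b = f a ∧ p b) (h1.and h2)).of_iff fun a => by simp

theorem of_primrecPred {p : α → Prop} (hp : PrimrecPred p) : Semi p := by
  obtain ⟨_, h⟩ := hp
  exact ⟨fun a _ => decide (p a), h.comp Primrec.fst, fun a => by simp⟩

theorem eq {f g : α → β} (hf : Computable f) (hg : Computable g) :
    Semi fun a => f a = g a := by
  classical
  exact (of_primrecPred (Primrec.eq (α := β))).comp (hf.pair hg)

theorem ne {f g : α → β} (hf : Computable f) (hg : Computable g) :
    Semi fun a => f a ≠ g a := by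
  classical
  exact (of_primrecPred (Primrec.eq (α := β)).not).comp (hf.pair hg)

theorem le {f g : α → ℕ} (hf : Computable f) (hg : Computable g) : Semi fun a => f a ≤ g a :=
  (of_primrecPred Primrec.nat_le).comp (hf.pair hg)

/-- A finite list collects one witness for each `i`, and checking such a list is a bounded, hence
primitive recursive, test. -/
theorem ball {p : α → ℕ → Prop} {k : α → ℕ} (hk : Computable k)
    (hp : Semi fun x : α × ℕ => p x.1 x.2) : Semi fun a => ∀ i < k a, p a i := by
  obtain ⟨D, hD, H⟩ := hp
  have key : Semi fun x : (α × ℕ) × List ℕ => ∀ i < x.1.2, D (x.1.1, i) (x.2.getD i 0) = true := by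
    refine of_primrecPred ?_
    have hR : PrimrecRel fun (i : ℕ) (x : (α × ℕ) × List ℕ) =>
        D (x.1.1, i) (x.2.getD i 0) = true := by
      refine Primrec.eq.comp (hD.comp (Primrec.pair (Primrec.fst.comp (Primrec.fst.comp Primrec.snd))
        Primrec.fst) ((Primrec.list_getD 0).comp (Primrec.snd.comp Primrec.snd) Primrec.fst))
        (Primrec.const true)
    exact (PrimrecRel.comp (f := fun x : (α × ℕ) × List ℕ => List.range x.1.2) (g := fun x => x)
      hR.forall_mem_list (Primrec.list_range.comp (Primrec.snd.comp Primrec.fst))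
      Primrec.id).of_eq fun x => by simp
  have h2 := (Semi.ex (p := fun (x : α × ℕ) (l : List ℕ) => ∀ i < x.2, D (x.1, i) (l.getD i 0) = true)
    key).comp (Computable.id.pair hk)
  refine h2.of_iff fun a => ⟨fun h => ?_, ?_⟩
  · have h' : ∀ i, ∃ w, i < k a → D (a, i) w = true := fun i => by
      by_cases hi : i < k a
      · obtain ⟨w, hw⟩ := (H (a, i)).1 (h i hi)
        exact ⟨w, fun _ => hw⟩
      · exact ⟨0, fun h => absurd h hi⟩
    choose w hw using h'
    refine ⟨(List.range (k a)).map w, fun i hi => ?_⟩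
    have hi' : i < k a := hi
    simp [List.getD, List.getElem?_range hi', hw i hi']
  · rintro ⟨l, hl⟩ i hi
    exact (H (a, i)).2 ⟨_, hl i hi⟩

/-- Elements of a list all satisfy a semidecidable predicate. -/
theorem list_forall {p : α → β → Prop} {l : α → List β} (hl : Computable l)
    (hp : Semi fun x : α × β => p x.1 x.2) : Semi fun a => ∀ b ∈ l a, p a b := by
  have : Semi fun a => ∀ i < (l a).length, ∃ b, (l a)[i]? = some b ∧ p a b :=
    ball (by fun_prop) (ex (and (eq (by fun_prop) (by fun_prop))
      (hp.comp (f := fun x : (α × ℕ) × β => (x.1.1, x.2)) (by fun_prop))))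
  refine this.of_iff fun a => ⟨fun h i hi => ⟨(l a)[i], by simp [hi], h _ (by simp)⟩, ?_⟩
  intro h b hb
  obtain ⟨i, hi, rfl⟩ := List.getElem_of_mem hb
  obtain ⟨b, hb, hpb⟩ := h i hi
  simp only [hi, List.getElem?_eq_getElem, Option.some.injEq] at hb
  exact hb ▸ hpb

theorem nodup {l : α → List β} (hl : Computable l) : Semi fun a => (l a).Nodup := by
  have : Semi fun a => ∀ i < (l a).length, ∀ j < i, (l a)[j]? ≠ (l a)[i]? :=
    ball (by fun_prop) (ball (by fun_prop) (ne (by fun_prop) (by fun_prop)))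
  refine this.of_iff fun a => ⟨fun h i hi j hj e => ?_, fun h => ?_⟩
  · exact hj.ne ((List.getElem?_inj (hj.trans hi) h).1 e)
  · rw [List.nodup_iff_getElem?_ne_getElem?]
    exact fun i j hij hj => h j hj i hij

/-- At least `k a` elements satisfy a semidecidable predicate. -/
theorem many {p : α → β → Prop} {k : α → ℕ} (hk : Computable k)
    (hp : Semi fun x : α × β => p x.1 x.2) :
    Semi fun a => ∃ s : Finset β, s.card = k a ∧ ∀ b ∈ s, p a b := by
  classical
  have : Semi fun a => ∃ l : List β, l.Nodup ∧ l.length = k a ∧ ∀ b ∈ l, p a b :=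
    Semi.ex (and (nodup (by fun_prop)) (and (eq (by fun_prop) (by fun_prop))
      (list_forall (by fun_prop) (hp.comp (f := fun x : (α × List β) × β => (x.1.1, x.2))
        (by fun_prop)))))
  refine this.of_iff fun a => ⟨?_, ?_⟩
  · rintro ⟨s, hs, h⟩
    exact ⟨s.toList, s.nodup_toList, by simp [hs], by simpa using h⟩
  · rintro ⟨l, hl, hk, h⟩
    exact ⟨l.toFinset, by rw [List.toFinset_card_of_nodup hl, hk], by simpa using h⟩

end Semi

/-! ### Enumeration of semidecidable sets -/

namespace Semi

variable {α β σ : Type} [Primcodable α] [Primcodable β] [Primcodable σ]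

/-- A semidecidable relation has a partial computable selector. -/
theorem exists_selector {p : α → σ → Prop} (hp : Semi fun x : α × σ => p x.1 x.2) :
    ∃ f : α →. σ, Partrec f ∧ (∀ a b, b ∈ f a → p a b) ∧ ∀ a b, p a b → (f a).Dom := by
  obtain ⟨D, hD, H⟩ := hp
  let g : α → ℕ → Option σ := fun a w => (decode (α := σ) w.unpair.1).bind fun b =>
    bif D (a, b) w.unpair.2 then some b else none
  have hg : Primrec₂ g := by
    have h1 : Primrec fun x : α × ℕ => x.2.unpair := Primrec.unpair.comp Primrec.snd
    refine Primrec.option_bind (Primrec.decode.comp (Primrec.fst.comp h1)) ?_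
    exact Primrec.cond (hD.comp (Primrec.pair (Primrec.fst.comp Primrec.fst) Primrec.snd)
      (Primrec.snd.comp (h1.comp Primrec.fst))) (Primrec.option_some.comp Primrec.snd)
      (Primrec.const none)
  refine ⟨fun a => Nat.rfindOpt (g a), Partrec.rfindOpt hg.to_comp, fun a b hb => ?_,
    fun a b hb => ?_⟩
  · obtain ⟨w, hw⟩ := Nat.rfindOpt_spec hb
    simp only [g, Option.mem_def, Option.bind_eq_some_iff, Bool.cond_eq_ite,
      Option.ite_none_right_eq_some, Option.some.injEq] at hw
    obtain ⟨b', _, hD', rfl⟩ := hw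
    exact (H (a, b')).2 ⟨_, hD'⟩
  · obtain ⟨w, hw⟩ := (H (a, b)).1 hb
    exact Nat.rfindOpt_dom.2 ⟨Nat.pair (encode b) w, b, by simp [g, hw]⟩

/-- The elements of a section of a semidecidable relation can be numbered effectively. -/
theorem exists_numbering {R : β → α → Prop} (hR : Semi fun x : β × α => R x.1 x.2) :
    ∃ Q : β → ℕ → α → Prop, (Semi fun x : (β × ℕ) × α => Q x.1.1 x.1.2 x.2) ∧
      (∀ b i a a', Q b i a → Q b i a' → a = a') ∧
      ∀ b a K, R b a → (∀ s : Finset α, (∀ a ∈ s, R b a) → s.card ≤ K) → ∃ i < K, Q b i a := by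
  classical
  obtain ⟨D, hD, H⟩ := hR
  -- Stage `w` codes a candidate together with a possible witness for it. A confirmed candidate is
  -- appended unless it is already listed.
  let step : β → ℕ × List α → List α := fun b p =>
    Option.casesOn (motive := fun _ => List α) (decode (α := α) p.1.unpair.1) p.2 fun a =>
      if D (b, a) p.1.unpair.2 = true ∧ ¬ ∃ a' ∈ p.2, a' = a then p.2 ++ [a] else p.2
  let L : β → ℕ → List α := fun b s => Nat.rec [] (fun w l => step b (w, l)) s
  have hstep : Primrec₂ step := by
    have h1 : Primrec fun x : β × ℕ × List α => x.2.1.unpair :=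
      Primrec.unpair.comp (Primrec.fst.comp Primrec.snd)
    refine Primrec.option_casesOn (Primrec.decode.comp (Primrec.fst.comp h1))
      (Primrec.snd.comp Primrec.snd) ?_
    have hl : Primrec fun x : (β × ℕ × List α) × α => x.1.2.2 :=
      Primrec.snd.comp (Primrec.snd.comp Primrec.fst)
    refine Primrec.ite (PrimrecPred.and ?_ (PrimrecPred.not ?_)) ?_ hl
    · exact Primrec.eq.comp (hD.comp ((Primrec.fst.comp Primrec.fst).pair Primrec.snd)
        (Primrec.snd.comp (h1.comp Primrec.fst))) (Primrec.const true)
    · exact PrimrecRel.comp (PrimrecRel.exists_mem_list Primrec.eq) hl Primrec.snd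
    · exact Primrec.list_concat.comp hl Primrec.snd
  have hL : Primrec₂ L := by
    refine Primrec.nat_rec (f := fun _ : β => ([] : List α)) (Primrec.const []) hstep
  have stepcases : ∀ b w l, step b (w, l) = l ∨
      ∃ a, step b (w, l) = l ++ [a] ∧ a ∉ l ∧ D (b, a) w.unpair.2 = true := by
    intro b w l
    simp only [step]
    rcases decode (α := α) w.unpair.1 with _ | a
    · exact Or.inl rfl
    · by_cases h : D (b, a) w.unpair.2 = true ∧ ¬ ∃ a' ∈ l, a' = a
      · refine Or.inr ⟨a, by simp only [if_pos h], by simpa using h.2, h.1⟩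
      · exact Or.inl (by simp only [if_neg h])
  have hpre : ∀ b s k, L b s <+: L b (s + k) := by
    intro b s k
    induction k with
    | zero => exact List.prefix_rfl
    | succ k ih =>
      refine ih.trans ?_
      change L b (s + k) <+: step b (s + k, L b (s + k))
      rcases stepcases b (s + k) (L b (s + k)) with h | ⟨a, h, _⟩ <;> rw [h]
      exact List.prefix_append _ _
  have hinv : ∀ b s, (L b s).Nodup ∧ ∀ a ∈ L b s, R b a := by
    intro b s
    induction s with
    | zero => simp [L]
    | succ s ih =>
      change (step b (s, L b s)).Nodup ∧ ∀ a ∈ step b (s, L b s), R b a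
      rcases stepcases b s (L b s) with h | ⟨a, h, h1, h2⟩ <;> rw [h]
      · exact ih
      · refine ⟨?_, fun a' ha' => ?_⟩
        · rw [← List.concat_eq_append]
          exact ih.1.concat h1
        · rcases List.mem_append.1 ha' with h' | h'
          · exact ih.2 a' h'
          · rw [List.mem_singleton.1 h']
            exact (H (b, a)).2 ⟨_, h2⟩
  have hmem : ∀ b a, R b a → ∃ s, a ∈ L b s := by
    intro b a hab
    obtain ⟨w, hw⟩ := (H (b, a)).1 hab
    refine ⟨Nat.pair (encode a) w + 1, ?_⟩
    change a ∈ step b (Nat.pair (encode a) w, L b (Nat.pair (encode a) w))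
    rcases Classical.em (a ∈ L b (Nat.pair (encode a) w)) with h | h
    · simp only [step, Nat.unpair_pair, encodek]
      split_ifs
      · exact List.mem_append_left _ h
      · exact h
    · simp only [step, Nat.unpair_pair, encodek]
      rw [if_pos ⟨hw, by simpa using h⟩]
      simp
  -- The number of an element is its position in the lists. It does not depend on the stage, because
  -- later lists extend earlier ones.
  refine ⟨fun b i a => ∃ s, (L b s)[i]? = some a, ?_, ?_, ?_⟩
  · have hL' : Computable fun x : β × ℕ => L x.1 x.2 := hL.to_comp
    exact ex (eq (by fun_prop) (by fun_prop))
  · rintro b i a a' ⟨s, hs⟩ ⟨s', hs'⟩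
    have h1 := hpre b s s'
    have h2 := hpre b s' s
    rw [add_comm] at h2
    have get_eq : ∀ {l l' : List α} {a}, l <+: l' → l[i]? = some a → l'[i]? = some a := by
      rintro l l' a ⟨r, rfl⟩ h
      rw [List.getElem?_append_left (List.getElem?_eq_some_iff.1 h).1, h]
    have e1 := get_eq h1 hs
    have e2 := get_eq h2 hs'
    exact Option.some.inj (e1.symm.trans e2)
  · intro b a K hab hK
    obtain ⟨s, hs⟩ := hmem b a hab
    obtain ⟨i, hi, rfl⟩ := List.getElem_of_mem hs
    refine ⟨i, lt_of_lt_of_le hi ?_, s, by simp [hi]⟩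
    have := hK (L b s).toFinset (fun a ha => (hinv b s).2 a (List.mem_toFinset.1 ha))
    rwa [List.toFinset_card_of_nodup (hinv b s).1] at this

end Semi

/-! ### Descriptions by an index in an enumeration -/

/-- The number with the given binary digits, the least significant digit first. -/
def binVal (l : Str) : ℕ := l.foldr (fun b v => 2 * v + b.toNat) 0

@[fun_prop]
theorem computable_binVal {α : Type} [Primcodable α] {f : α → Str} (hf : Computable f) :
    Computable fun a => binVal (f a) := by
  have : Primrec binVal := by
    refine Primrec.list_foldr (f := fun l : Str => l) (g := fun _ => 0)
      (h := fun _ p => 2 * p.2 + p.1.toNat) Primrec.id (Primrec.const 0) ?_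
    exact Primrec.nat_add.comp (Primrec.nat_double.comp (Primrec.snd.comp Primrec.snd))
      ((Primrec.dom_bool Bool.toNat).comp (Primrec.fst.comp Primrec.snd))
  exact this.to_comp.comp hf

theorem exists_binVal_eq (k i : ℕ) (hi : i < 2 ^ k) : ∃ l : Str, l.length = k ∧ binVal l = i := by
  induction k generalizing i with
  | zero => exact ⟨[], rfl, by simp at hi; simp [binVal, hi]⟩
  | succ k ih =>
    obtain ⟨l, hl, hv⟩ := ih (i / 2) (by rw [pow_succ] at hi; omega)
    refine ⟨decide (i % 2 = 1) :: l, by simp [hl], ?_⟩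
    have h : binVal (decide (i % 2 = 1) :: l) = 2 * binVal l + (decide (i % 2 = 1)).toNat := rfl
    rw [h, hv]
    rcases Nat.mod_two_eq_zero_or_one i with h | h <;> simp [h] <;> omega

section Optimal

variable {α β ε : Type} [Primcodable α] [Primcodable β] [Primcodable ε]

theorem replicate_append_inj {j j' : ℕ} {p p' : Str}
    (h : List.replicate j true ++ false :: p = List.replicate j' true ++ false :: p') :
    j = j' ∧ p = p' := by
  induction j generalizing j' with
  | zero =>
    cases j' with
    | zero => simpa using h
    | succ j' => simp [List.replicate_succ] at h
  | succ j ih =>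
    cases j' with
    | zero => simp [List.replicate_succ] at h
    | succ j' =>
      simp only [List.replicate_succ, List.cons_append, List.cons.injEq, true_and] at h
      have := ih h
      exact ⟨by omega, this.2⟩

/-- The program is 1^l 0 r i, where r is the code of `e` in l binary digits and i, in k digits, is
the number of `a` in the enumeration of its section. The unary prefix marks where r ends (only the
length of `u` matters), and i is whatever remains; the total length is k + 2l + 1. -/
theorem IsOptimal.exists_program {U : DescriptionMethod} (hU : IsOptimal U)
    {R : ε → β → α → Prop} (hR : Semi fun x : (ε × β) × α => R x.1.1 x.1.2 x.2) :
    ∃ c : ℕ, ∀ (l k : ℕ) (e : ε) (b : β) (a : α), encode e < 2 ^ l → R e b a →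
      (∀ s : Finset α, (∀ a ∈ s, R e b a) → s.card ≤ 2 ^ k) →
      ∃ q : Str, encode a ∈ U q (encode b) ∧ q.length ≤ k + 2 * l + c := by
  obtain ⟨Q, hQ, hfun, hex⟩ := Semi.exists_numbering (R := fun x : ε × β => R x.1 x.2) hR
  let W : Str × ℕ → ℕ → Prop := fun y v => ∃ (e : ε) (b : β) (a : α) (u r i : Str),
    y.1 = (List.replicate u.length true ++ false :: (r ++ i)) ∧ r.length = u.length ∧
    encode e = binVal r ∧ encode b = y.2 ∧ encode a = v ∧ Q (e, b) (binVal i) a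
  have hW : Semi fun x : (Str × ℕ) × ℕ => W x.1 x.2 := by
    have hrep : Computable fun u : Str => List.replicate u.length true := by
      refine (Primrec.list_map (g := fun _ _ => true) Primrec.id (Primrec.const _).to₂).to_comp.of_eq
        fun u => ?_
      simp
    have henc : ∀ {γ : Type} [Primcodable γ], Computable (encode : γ → ℕ) := Computable.encode
    refine Semi.ex <| Semi.ex <| Semi.ex <| Semi.ex <| Semi.ex <| Semi.ex <|
      Semi.and (Semi.eq (by fun_prop) ?_) <| Semi.and (Semi.eq (by fun_prop) (by fun_prop)) <|
      Semi.and (Semi.eq (henc.comp (by fun_prop)) (by fun_prop)) <|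
      Semi.and (Semi.eq (henc.comp (by fun_prop)) (by fun_prop)) <|
      Semi.and (Semi.eq (henc.comp (by fun_prop)) (by fun_prop)) <|
      hQ.comp (f := fun x : ((((((((Str × ℕ) × ℕ) × ε) × β) × α) × Str) × Str) × Str) =>
        (((x.1.1.1.1.1.2, x.1.1.1.1.2), binVal x.2), x.1.1.1.2)) (by fun_prop)
    exact Computable.append_comp (hrep.comp (by fun_prop)) (by fun_prop)
  have hWfun : ∀ y v v', W y v → W y v' → v = v' := by
    rintro ⟨p, n⟩ v v' ⟨e, b, a, u, r, i, hp, hr, he, hb, ha, hq⟩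
      ⟨e', b', a', u', r', i', hp', hr', he', hb', ha', hq'⟩
    simp only at hp hp' hb hb'
    obtain ⟨h1, h2⟩ := replicate_append_inj (hp.symm.trans hp')
    obtain ⟨rfl, rfl⟩ := List.append_inj h2 (by omega)
    obtain rfl : e = e' := encode_injective (he.trans he'.symm)
    obtain rfl : b = b' := encode_injective (hb.trans hb'.symm)
    rw [← ha, ← ha', hfun _ _ _ _ hq hq']
  obtain ⟨f, hf, hfW, hdom⟩ := Semi.exists_selector hW
  obtain ⟨c, hc⟩ := hU.2 (fun p b => f (p, b)) hf.to₂
  refine ⟨c + 1, fun l k e b a he hab hk => ?_⟩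
  obtain ⟨i, hi, hqi⟩ := hex (e, b) a (2 ^ k) hab hk
  obtain ⟨r, hr, hrv⟩ := exists_binVal_eq l _ he
  obtain ⟨s, hs, hsv⟩ := exists_binVal_eq k i hi
  have hw : W (List.replicate r.length true ++ false :: (r ++ s), encode b) (encode a) :=
    ⟨e, b, a, r, r, s, rfl, rfl, hrv.symm, rfl, rfl, by rw [hsv]; exact hqi⟩
  have hd := hdom _ _ hw
  have hv := hWfun _ _ _ hw (hfW _ _ (Part.get_mem hd))
  obtain ⟨q, hq, hlen⟩ := hc _ (encode a) (encode b) (by rw [hv]; exact Part.get_mem hd)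
  refine ⟨q, hq, hlen.trans ?_⟩
  simp [hr, hs]
  omega

/-- Every object has a shortest description. -/
theorem IsOptimal.exists_shortest {U : DescriptionMethod} (hU : IsOptimal U) (a : α) (b : β) :
    ∃ p : Str, encode a ∈ U p (encode b) ∧ p.length = condC U a b := by
  obtain ⟨c, hc⟩ := hU.exists_program (R := fun (e : α) (_ : β) (a : α) => e = a)
    (Semi.eq (by fun_prop) (by fun_prop))
  -- The object serves as its own parameter. Only the existence of a program matters: it rules out
  -- the default value 0 of the infimum of the empty set.
  obtain ⟨q, hq, -⟩ := hc (encode a) 0 a b a Nat.lt_two_pow_self rfl (fun s hs => by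
    rw [pow_zero, Finset.card_le_one]
    intro x hx y hy
    rw [← hs x hx, ← hs y hy])
  exact Nat.sInf_mem (s := {l : ℕ | ∃ p : Str, encode a ∈ U p (encode b) ∧ p.length = l})
    ⟨_, q, hq, rfl⟩

theorem condC_le_length {U : DescriptionMethod} {a : α} {b : β} {p : Str}
    (h : encode a ∈ U p (encode b)) : condC U a b ≤ p.length :=
  Nat.sInf_le ⟨p, h, rfl⟩

/-- An element of a small set that can be enumerated from `b` and a parameter `e` is simple
given `b`. -/
theorem IsOptimal.condC_le {U : DescriptionMethod} (hU : IsOptimal U)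
    {R : ε → β → α → Prop} (hR : Semi fun x : (ε × β) × α => R x.1.1 x.1.2 x.2) :
    ∃ c : ℕ, ∀ (l k : ℕ) (e : ε) (b : β) (a : α), encode e < 2 ^ l → R e b a →
      (∀ s : Finset α, (∀ a ∈ s, R e b a) → s.card ≤ 2 ^ k) →
      condC U a b ≤ k + 2 * l + c := by
  obtain ⟨c, hc⟩ := hU.exists_program hR
  refine ⟨c, fun l k e b a he hab hk => ?_⟩
  obtain ⟨q, hq, hlen⟩ := hc l k e b a he hab hk
  exact (condC_le_length hq).trans hlen

theorem IsOptimal.condC_le_iff {U : DescriptionMethod} (hU : IsOptimal U) (a : α) (b : β) (k : ℕ) :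
    condC U a b ≤ k ↔ ∃ p : Str, p.length ≤ k ∧ encode a ∈ U p (encode b) := by
  constructor
  · intro h
    obtain ⟨p, hp, hl⟩ := hU.exists_shortest a b
    exact ⟨p, hl ▸ h, hp⟩
  · rintro ⟨p, hl, hp⟩
    exact (condC_le_length hp).trans hl

/-- Upper bounds on complexity are recognised by finding a program, although complexity itself is
not computable. This is why the sets enumerated below are cut out by conditions `condC ≤ k`. -/
theorem IsOptimal.semi_condC_le {U : DescriptionMethod} (hU : IsOptimal U) {γ : Type}
    [Primcodable γ] {f : γ → α} {g : γ → β} {k : γ → ℕ} (hf : Computable f) (hg : Computable g)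
    (hk : Computable k) : Semi fun x => condC U (f x) (g x) ≤ k x := by
  have henc : ∀ {γ : Type} [Primcodable γ], Computable (encode : γ → ℕ) := Computable.encode
  have hUs : Semi fun x : (Str × ℕ) × ℕ => x.2 ∈ U x.1.1 x.1.2 := Semi.of_partrec hU.1
  have : Semi fun x => ∃ p : Str, p.length ≤ k x ∧ encode (f x) ∈ U p (encode (g x)) := by
    refine Semi.ex (Semi.and (Semi.le (by fun_prop) (by fun_prop)) (hUs.comp
      (f := fun x : γ × Str => ((x.2, encode (g x.1)), encode (f x.1))) ?_))
    exact Computable.pair (Computable.pair (by fun_prop) (henc.comp (by fun_prop)))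
      (henc.comp (by fun_prop))
  exact this.of_iff fun x => hU.condC_le_iff _ _ _

/-- A final `true` is the leading binary digit, so the value of `p ++ [true]` determines `p`
including its length, and it is below 2^(k+1). -/
theorem card_strings_length_le (k : ℕ) (s : Finset Str) (hs : ∀ p ∈ s, p.length ≤ k) :
    s.card ≤ 2 ^ (k + 1) := by
  have h : ∀ p : Str, binVal (p ++ [true]) < 2 ^ (p.length + 1) ∧
      2 ^ p.length ≤ binVal (p ++ [true]) := by
    intro p
    induction p with
    | nil => simp [binVal]
    | cons b p ih =>
      have h : binVal (b :: p ++ [true]) = 2 * binVal (p ++ [true]) + b.toNat := rfl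
      have hb : b.toNat ≤ 1 := Bool.toNat_le b
      rw [h, List.length_cons, pow_succ, pow_succ 2 p.length]
      rw [pow_succ] at ih
      omega
  have hinj : ∀ p q : Str, binVal (p ++ [true]) = binVal (q ++ [true]) → p = q := by
    intro p
    induction p with
    | nil =>
      intro q hq
      cases q with
      | nil => rfl
      | cons b q =>
        have h1 := (h (b :: q)).2
        have h2 : 2 ^ 1 ≤ 2 ^ (b :: q).length := Nat.pow_le_pow_right (by norm_num) (by simp)
        rw [← hq] at h1
        simp [binVal] at h1 h2
    | cons b p ih =>
      intro q hq
      cases q with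
      | nil =>
        have h1 := (h (b :: p)).2
        have h2 : 2 ^ 1 ≤ 2 ^ (b :: p).length := Nat.pow_le_pow_right (by norm_num) (by simp)
        rw [hq] at h1
        simp [binVal] at h1 h2
      | cons b' q =>
        have e1 : binVal (b :: p ++ [true]) = 2 * binVal (p ++ [true]) + b.toNat := rfl
        have e2 : binVal (b' :: q ++ [true]) = 2 * binVal (q ++ [true]) + b'.toNat := rfl
        rw [e1, e2] at hq
        have hb : b.toNat ≤ 1 := Bool.toNat_le b
        have hb' : b'.toNat ≤ 1 := Bool.toNat_le b'
        rw [ih q (by omega)]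
        have : b.toNat = b'.toNat := by omega
        congr 1
        revert this
        cases b <;> cases b' <;> simp
  calc s.card = (s.image fun p => binVal (p ++ [true])).card :=
        (Finset.card_image_of_injective _ fun p q hpq => hinj p q hpq).symm
    _ ≤ (Finset.range (2 ^ (k + 1))).card := by
        refine Finset.card_le_card fun v hv => ?_
        obtain ⟨p, hp, rfl⟩ := Finset.mem_image.1 hv
        exact Finset.mem_range.2 ((h p).1.trans_le
          (Nat.pow_le_pow_right (by norm_num) (by have := hs p hp; omega)))
    _ = 2 ^ (k + 1) := by simp

/-- There are at most `2 ^ (k + 1)` objects of complexity at most `k`. -/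
theorem IsOptimal.card_condC_le {U : DescriptionMethod} (hU : IsOptimal U) (b : β) (k : ℕ)
    (s : Finset α) (hs : ∀ a ∈ s, condC U a b ≤ k) : s.card ≤ 2 ^ (k + 1) := by
  classical
  choose! p hp hl using fun a : α => hU.exists_shortest a b
  rw [← Finset.card_image_of_injective s (f := p) fun a a' h => encode_injective
    (Part.mem_unique (hp a) (h ▸ hp a'))]
  refine card_strings_length_le k _ fun q hq => ?_
  obtain ⟨a, ha, rfl⟩ := Finset.mem_image.1 hq
  exact (hl a).le.trans (hs a ha)

end Optimal

/-! ### Counting -/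

/-- At most `K` elements satisfy `p`. -/
def AtMost {α : Type} (K : ℕ) (p : α → Prop) : Prop :=
  ∀ s : Finset α, (∀ a ∈ s, p a) → s.card ≤ K

namespace AtMost

variable {α β : Type}

theorem mono {K : ℕ} {p q : α → Prop} (hp : AtMost K p) (h : ∀ a, q a → p a) : AtMost K q :=
  fun s hs => hp s fun a ha => h a (hs a ha)

theorem mono_right {K K' : ℕ} {p : α → Prop} (hp : AtMost K p) (h : K ≤ K') : AtMost K' p :=
  fun s hs => (hp s hs).trans h

theorem one {p : α → Prop} (h : ∀ a a', p a → p a' → a = a') : AtMost 1 p :=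
  fun _ hs => Finset.card_le_one.2 fun a ha a' ha' => h a a' (hs a ha) (hs a' ha')

theorem of_injOn {K : ℕ} {p : α → Prop} {q : β → Prop} (hq : AtMost K q) (f : α → β)
    (hf : ∀ a, p a → q (f a)) (hinj : ∀ a a', p a → p a' → f a = f a' → a = a') : AtMost K p := by
  classical
  intro s hs
  rw [← Finset.card_image_of_injOn (s := s) (f := f)
    fun a ha a' ha' h => hinj a a' (hs a ha) (hs a' ha') h]
  refine hq _ fun b hb => ?_
  obtain ⟨a, ha, rfl⟩ := Finset.mem_image.1 hb
  exact hf a (hs a ha)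

theorem sigma {A B : ℕ} {p : α → Prop} {q : α → β → Prop} (hp : AtMost A p)
    (hq : ∀ a, p a → AtMost B (q a)) : AtMost (A * B) fun x : α × β => p x.1 ∧ q x.1 x.2 := by
  classical
  intro s hs
  refine (Finset.card_le_mul_card_image (f := Prod.fst) s B fun a ha => ?_).trans ?_
  · obtain ⟨x, hx, rfl⟩ := Finset.mem_image.1 ha
    rw [← Finset.card_image_of_injOn (f := Prod.snd)]
    · refine hq x.1 (hs x hx).1 _ fun b hb => ?_
      obtain ⟨y, hy, rfl⟩ := Finset.mem_image.1 hb
      obtain ⟨hy, he⟩ := Finset.mem_filter.1 hy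
      exact he ▸ (hs y hy).2
    · intro y hy z hz h
      simp only [Finset.coe_filter, Set.mem_ofPred_eq] at hy hz
      exact Prod.ext (hy.2.trans hz.2.symm) h
  · rw [mul_comm]
    refine Nat.mul_le_mul_right _ (hp _ fun a ha => ?_)
    obtain ⟨x, hx, rfl⟩ := Finset.mem_image.1 ha
    exact (hs x hx).1

theorem ex {A B : ℕ} {p : α → Prop} {q : α → β → Prop} (hp : AtMost A p)
    (hq : ∀ a, p a → AtMost B (q a)) : AtMost (A * B) fun b => ∃ a, p a ∧ q a b := by
  intro s hs
  rcases s.eq_empty_or_nonempty with rfl | ⟨b₀, hb₀⟩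
  · simp
  have : Nonempty α := ⟨(hs b₀ hb₀).choose⟩
  choose! f hf using hs
  have h := (hp.sigma hq) (s.map ⟨fun b => (f b, b), fun b b' h => (Prod.ext_iff.1 h).2⟩) (by
    intro x hx
    obtain ⟨b, hb, rfl⟩ := Finset.mem_map.1 hx
    exact hf b hb)
  rwa [Finset.card_map] at h

theorem of_fibers {K M : ℕ} {q : α → β → Prop}
    (hK : AtMost K fun x : α × β => q x.1 x.2) (s : Finset α)
    (hs : ∀ a ∈ s, ∃ T : Finset β, T.card = M ∧ ∀ b ∈ T, q a b) : s.card * M ≤ K := by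
  classical
  choose! T hT hq using hs
  have h := hK ((s.sigma T).map ⟨fun x => (x.1, x.2), fun x y h => by
    obtain ⟨h1, h2⟩ := Prod.ext_iff.1 h
    exact Sigma.ext h1 (heq_of_eq h2)⟩) (by
      intro x hx
      obtain ⟨y, hy, rfl⟩ := Finset.mem_map.1 hx
      obtain ⟨h1, h2⟩ := Finset.mem_sigma.1 hy
      exact hq _ h1 _ h2)
  rwa [Finset.card_map, Finset.card_sigma, Finset.sum_congr rfl hT, Finset.sum_const,
    smul_eq_mul] at h

/-- The number of elements of a nonempty finite set is between two consecutive powers of two. -/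
theorem exists_log {K : ℕ} {p : α → Prop} (hp : AtMost K p) (a : α) (ha : p a) :
    ∃ u, (∃ s : Finset α, s.card = 2 ^ u ∧ ∀ a ∈ s, p a) ∧ AtMost (2 ^ (u + 1)) p := by
  classical
  have hex : ∃ v, AtMost (2 ^ v) p := ⟨K, hp.mono_right Nat.lt_two_pow_self.le⟩
  rcases h : Nat.find hex with _ | u
  · exact ⟨0, ⟨{a}, by simp, by simpa using ha⟩,
      (h ▸ Nat.find_spec hex : AtMost (2 ^ 0) p).mono_right (by norm_num)⟩
  · refine ⟨u, ?_, h ▸ Nat.find_spec hex⟩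
    have hu := Nat.find_min hex (m := u) (by omega)
    simp only [AtMost, not_forall, not_le] at hu
    obtain ⟨s, hs, hc⟩ := hu
    obtain ⟨s', hs', hc'⟩ := Finset.exists_subset_card_eq hc.le
    exact ⟨s', hc', fun a ha => hs a (hs' ha)⟩

end AtMost

/-! ### Calculus of complexities up to logarithmic terms -/

/-- Each pairing at most doubles the length of the code. This is the source of the factors 2, 4, 8,
16, 128 in front of `l` for tuples of parameters. -/
theorem encode_pair_lt {α β : Type} [Encodable α] [Encodable β] {i l : ℕ} {a : α} {b : β}
    (ha : encode a < 2 ^ (i * l)) (hb : encode b < 2 ^ (i * l)) :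
    encode (a, b) < 2 ^ (2 * i * l) := by
  have h := Nat.pair_lt_max_add_one_sq (encode a) (encode b)
  have h2 : max (encode a) (encode b) + 1 ≤ 2 ^ (i * l) := by
    have := max_lt ha hb
    omega
  calc encode (a, b) = Nat.pair (encode a) (encode b) := rfl
    _ < (max (encode a) (encode b) + 1) ^ 2 := h
    _ ≤ (2 ^ (i * l)) ^ 2 := Nat.pow_le_pow_left h2 2
    _ = 2 ^ (2 * i * l) := by rw [← pow_mul]; congr 1; ring

theorem encode_cons_lt {β : Type} [Encodable β] (i : ℕ) {l : ℕ} {a : ℕ} {b : β}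
    (ha : a < 2 ^ l) (hb : encode b < 2 ^ ((i + 1) * l)) :
    encode (a, b) < 2 ^ (2 * (i + 1) * l) :=
  encode_pair_lt (ha.trans_le (Nat.pow_le_pow_right (by norm_num) (by nlinarith))) hb

theorem encode_nat_lt {l a : ℕ} (ha : a < 2 ^ l) : encode a < 2 ^ ((0 + 1) * l) := by
  simpa using ha

theorem encode_nat₂_lt {l a b : ℕ} (ha : a < 2 ^ l) (hb : b < 2 ^ l) :
    encode (a, b) < 2 ^ (2 * l) :=
  encode_cons_lt 0 ha (encode_nat_lt hb)

theorem encode_nat₃_lt {l a b c : ℕ} (ha : a < 2 ^ l) (hb : b < 2 ^ l) (hc : c < 2 ^ l) :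
    encode (a, b, c) < 2 ^ (4 * l) :=
  encode_cons_lt 1 ha (encode_nat₂_lt hb hc)

section Optimal

variable {α β γ ε σ : Type} [Primcodable α] [Primcodable β] [Primcodable γ] [Primcodable ε]
  [Primcodable σ] {U : DescriptionMethod}

/-- An element of a small set that can be enumerated from `b` and a parameter `e` is simple
given `b`. -/
theorem IsOptimal.condC_le_add_mul (hU : IsOptimal U) (D : ℕ) {R : ε → β → α → Prop}
    (hR : Semi fun x : (ε × β) × α => R x.1.1 x.1.2 x.2) :
    ∃ c : ℕ, ∀ l : ℕ, 1 ≤ l → ∀ (k : ℕ) (e : ε) (b : β) (a : α), encode e < 2 ^ (D * l) →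
      AtMost (2 ^ k) (R e b) → R e b a → condC U a b ≤ k + c * l := by
  obtain ⟨c, hc⟩ := hU.condC_le hR
  refine ⟨2 * D + c, fun l hl k e b a he hk ha => (hc (D * l) k e b a he ha hk).trans ?_⟩
  nlinarith [Nat.mul_le_mul_left c hl]

theorem IsOptimal.atMost (hU : IsOptimal U) (b : β) (k : ℕ) :
    AtMost (2 ^ (k + 1)) fun a : α => condC U a b ≤ k :=
  hU.card_condC_le b k

/-- The difficult half of the symmetry of information. -/
theorem IsOptimal.plainC_add_condC_le (hU : IsOptimal U) :
    ∃ c : ℕ, ∀ l : ℕ, 1 ≤ l → ∀ (a : α) (b : β), plainC U (a, b) < 2 ^ l →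
      plainC U a + condC U b a ≤ plainC U (a, b) + c * l := by
  obtain ⟨c₁, h₁⟩ := hU.condC_le_add_mul 1
    (R := fun (k : ℕ) (a : α) (b : β) => condC U (a, b) () ≤ k)
    (hU.semi_condC_le (by fun_prop) (by fun_prop) (by fun_prop))
  obtain ⟨c₂, h₂⟩ := hU.condC_le_add_mul 4
    (R := fun (e : ℕ × ℕ) (_ : Unit) (a : α) =>
      ∃ s : Finset β, s.card = 2 ^ e.2 ∧ ∀ b ∈ s, condC U (a, b) () ≤ e.1)
    (Semi.many (by fun_prop) (hU.semi_condC_le (by fun_prop) (by fun_prop) (by fun_prop)))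
  refine ⟨c₁ + c₂ + 2, fun l hl a b hlt => ?_⟩
  have hall : AtMost (2 ^ (plainC U (a, b) + 1)) fun x : α × β =>
      condC U x () ≤ plainC U (a, b) := hU.atMost () _
  have hsec : AtMost (2 ^ (plainC U (a, b) + 1)) fun b' : β =>
      condC U (a, b') () ≤ plainC U (a, b) :=
    hall.of_injOn (fun b' => (a, b')) (fun _ h => h) fun _ _ _ _ h => (Prod.ext_iff.1 h).2
  -- Up to a factor 2, the section over `a` of the set of pairs no more complex than (a,b) has 2^u
  -- elements. So `b` costs about u bits given `a`, while at most 2^(C(a,b)+1-u) first components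
  -- have so large a section.
  obtain ⟨u, ⟨s, hs, hs'⟩, hu⟩ := hsec.exists_log b le_rfl
  have hu1 : u ≤ plainC U (a, b) + 1 := by
    have := hsec s hs'
    rw [hs] at this
    exact (Nat.pow_le_pow_iff_right (by norm_num)).1 this
  have e₁ := h₁ l hl (u + 1) (plainC U (a, b)) a b (by simpa using hlt) hu le_rfl
  have hlt' : plainC U (a, b) < 2 ^ (2 * l) :=
    hlt.trans_le (Nat.pow_le_pow_right (by norm_num) (by omega))
  have hu2 : u < 2 ^ (2 * l) := by
    have h4 : 2 ^ 1 ≤ 2 ^ l := Nat.pow_le_pow_right (by norm_num) hl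
    have : 2 ^ (2 * l) = 2 ^ l * 2 ^ l := by rw [← pow_add]; congr 1; omega
    nlinarith
  have e₂ := h₂ l hl (plainC U (a, b) + 1 - u) (plainC U (a, b), u) () a
    ((encode_nat₂_lt hlt' hu2).trans_le (Nat.pow_le_pow_right (by norm_num) (by omega)))
    (fun S hS => by
      have := hall.of_fibers (q := fun a' b' => condC U (a', b') () ≤ plainC U (a, b)) S hS
      refine Nat.le_of_mul_le_mul_right (this.trans ?_) (Nat.two_pow_pos u)
      rw [← pow_add]
      exact Nat.pow_le_pow_right (by norm_num) (by omega)) ⟨s, hs, hs'⟩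
  have e₃ : plainC U a ≤ plainC U (a, b) + 1 - u + c₂ * l := e₂
  have : (c₁ + c₂ + 2) * l = c₁ * l + c₂ * l + 2 * l := by ring
  omega

/-- Description in two steps: first `w` given `e`, then `v` given what is computed from `w`
and `e`. -/
theorem IsOptimal.condC_le_two_step (hU : IsOptimal U) (D : ℕ) {δ : Type} [Primcodable δ]
    {g : ε × γ × α → σ} (hg : Computable g) {h : ε × γ × α × β → δ} (hh : Computable h) :
    ∃ c : ℕ, ∀ l : ℕ, 1 ≤ l → ∀ (p : ε) (e : γ) (w : α) (v : β), encode p < 2 ^ (D * l) →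
      condC U w e < 2 ^ l → condC U v (g (p, e, w)) < 2 ^ l →
      condC U (h (p, e, w, v)) e ≤ condC U w e + condC U v (g (p, e, w)) + c * l := by
  obtain ⟨c, hc⟩ := hU.condC_le_add_mul (2 * (2 * (D + 1)))
    (R := fun (q : ℕ × ℕ × ε) (e : γ) (x : δ) => ∃ w : α, condC U w e ≤ q.1 ∧
      ∃ v : β, condC U v (g (q.2.2, e, w)) ≤ q.2.1 ∧ x = h (q.2.2, e, w, v))
    (Semi.ex (Semi.and (hU.semi_condC_le (by fun_prop) (by fun_prop) (by fun_prop))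
      (Semi.ex (Semi.and (hU.semi_condC_le (by fun_prop) (by fun_prop) (by fun_prop))
        (Semi.eq (by fun_prop) (by fun_prop))))))
  refine ⟨c + 2, fun l hl p e w v hp hw hv => ?_⟩
  have := hc l hl (condC U w e + 1 + (condC U v (g (p, e, w)) + 1))
    (condC U w e, condC U v (g (p, e, w)), p) e (h (p, e, w, v))
    (encode_cons_lt (2 * D + 1) hw ((encode_cons_lt D hv (hp.trans_le
      (Nat.pow_le_pow_right (by norm_num) (by nlinarith)))).trans_le
        (Nat.pow_le_pow_right (by norm_num) (by nlinarith))) |>.trans_le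
        (Nat.pow_le_pow_right (by norm_num) (by nlinarith))) ?_ ⟨w, le_rfl, v, le_rfl, rfl⟩
  · nlinarith
  · rw [pow_add]
    refine (hU.atMost e _).ex fun w' _ => ?_
    have := (hU.atMost (α := β) (g (p, e, w')) (condC U v (g (p, e, w)))).ex (β := δ) (B := 1)
      (q := fun v x => x = h (p, e, w', v)) fun v _ => AtMost.one fun a a' h h' => h.trans h'.symm
    rwa [mul_one] at this

/-- Whatever is computed from `b` and an object `w` is not more complex, given `b`, than `w`
is given something computed from `b`. -/
theorem IsOptimal.condC_le_of_graph (hU : IsOptimal U) (D : ℕ) {g : ε × γ → σ}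
    (hg : Computable g) {G : ε → α → β → Prop}
    (hG : Semi fun x : (ε × α) × β => G x.1.1 x.1.2 x.2)
    (hfun : ∀ p w v v', G p w v → G p w v' → v = v') :
    ∃ c : ℕ, ∀ l : ℕ, 1 ≤ l → ∀ (p : ε) (e : γ) (w : α) (v : β), encode p < 2 ^ (D * l) →
      condC U w (g (p, e)) < 2 ^ l → G p w v →
      condC U v e ≤ condC U w (g (p, e)) + c * l := by
  obtain ⟨c, hc⟩ := hU.condC_le_add_mul (2 * (D + 1))
    (R := fun (q : ℕ × ε) (e : γ) (x : β) => ∃ w : α, condC U w (g (q.2, e)) ≤ q.1 ∧ G q.2 w x)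
    (Semi.ex (Semi.and (hU.semi_condC_le (by fun_prop) (by fun_prop) (by fun_prop))
      (hG.comp (f := fun x : (((ℕ × ε) × γ) × β) × α => ((x.1.1.1.2, x.2), x.1.2))
        (by fun_prop))))
  refine ⟨c + 1, fun l hl p e w v hp hw hv => ?_⟩
  have := hc l hl (condC U w (g (p, e)) + 1) (condC U w (g (p, e)), p) e v
    (encode_cons_lt D hw (hp.trans_le (Nat.pow_le_pow_right (by norm_num) (by nlinarith)))) ?_
    ⟨w, le_rfl, hv⟩
  · nlinarith
  · have := (hU.atMost (α := α) (g (p, e)) (condC U w (g (p, e)))).ex (β := β) (B := 1)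
      (q := fun w x => G p w x) fun w _ => AtMost.one (hfun p w)
    rwa [mul_one] at this

end Optimal

/-! ### Edges between sets of vertices -/

/-- Cauchy-Schwarz over `S` leads to counting the common neighbours in `S` of pairs b, b' in `T`. If
the `R`-components agree, there are at most |S| of them, and each b has at most |A| such partners in
`T`. Otherwise at most d common `L`-components, each with |A| labels, are available. -/
theorem card_edges_sq_le {L R A : Type} [Fintype A] [DecidableEq R] (E : L → R → Prop)
    [∀ x y, Decidable (E x y)] {d : ℕ}
    (hE : ∀ y y', y ≠ y' → AtMost d fun x => E x y ∧ E x y')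
    (S : Finset (L × A)) (T : Finset (R × A)) :
    ((S ×ˢ T).filter fun p => E p.1.1 p.2.1).card ^ 2 ≤
      Fintype.card A * S.card * T.card * (S.card + d * T.card) := by
  classical
  have hcard : ((S ×ˢ T).filter fun p => E p.1.1 p.2.1).card =
      ∑ a ∈ S, ∑ b ∈ T, if E a.1 b.1 then 1 else 0 := by
    rw [Finset.card_filter, Finset.sum_product]
  have hpair : ∀ b ∈ T, ∀ b' ∈ T,
      (∑ a ∈ S, (if E a.1 b.1 then 1 else 0) * (if E a.1 b'.1 then 1 else 0)) ≤
        (if b.1 = b'.1 then S.card else 0) + d * Fintype.card A := by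
    intro b _ b' _
    have h1 : (∑ a ∈ S, (if E a.1 b.1 then 1 else 0) * (if E a.1 b'.1 then 1 else 0)) =
        (S.filter fun a => E a.1 b.1 ∧ E a.1 b'.1).card := by
      rw [Finset.card_filter]
      refine Finset.sum_congr rfl fun a _ => ?_
      by_cases h : E a.1 b.1 <;> by_cases h' : E a.1 b'.1 <;> simp [h, h']
    rw [h1]
    split_ifs with h
    · exact (Finset.card_filter_le _ _).trans (Nat.le_add_right _ _)
    · rw [zero_add]
      have := (hE _ _ h).sigma (β := A) (B := Fintype.card A) (q := fun _ _ => True)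
        fun _ _ s _ => s.card_le_univ
      refine this _ fun a ha => ⟨(Finset.mem_filter.1 ha).2, trivial⟩
  have hsame : ∀ b ∈ T, (∑ b' ∈ T, if b.1 = b'.1 then S.card else 0) ≤
      Fintype.card A * S.card := by
    intro b _
    rw [← Finset.sum_filter, Finset.sum_const, smul_eq_mul]
    refine Nat.mul_le_mul_right _ ?_
    rw [← Finset.card_image_of_injOn (f := Prod.snd)]
    · exact Finset.card_le_univ _
    · intro p hp p' hp' h
      simp only [Finset.coe_filter, Set.mem_ofPred_eq] at hp hp'
      exact Prod.ext (hp.2.symm.trans hp'.2) h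
  rw [hcard]
  calc (∑ a ∈ S, ∑ b ∈ T, if E a.1 b.1 then 1 else 0) ^ 2
      ≤ S.card * ∑ a ∈ S, (∑ b ∈ T, if E a.1 b.1 then 1 else 0) ^ 2 :=
        sq_sum_le_card_mul_sum_sq
    _ = S.card * ∑ b ∈ T, ∑ b' ∈ T, ∑ a ∈ S,
          (if E a.1 b.1 then 1 else 0) * (if E a.1 b'.1 then 1 else 0) := by
        congr 1
        simp_rw [sq, Finset.sum_mul_sum]
        rw [Finset.sum_comm]
        exact Finset.sum_congr rfl fun b _ => Finset.sum_comm
    _ ≤ S.card * ∑ b ∈ T, (Fintype.card A * S.card + T.card * (d * Fintype.card A)) := by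
        refine Nat.mul_le_mul_left _ (Finset.sum_le_sum fun b hb => ?_)
        refine (Finset.sum_le_sum fun b' hb' => hpair b hb b' hb').trans ?_
        rw [Finset.sum_add_distrib, Finset.sum_const, smul_eq_mul]
        exact Nat.add_le_add_right (hsame b hb) _
    _ = Fintype.card A * S.card * T.card * (S.card + d * T.card) := by
        rw [Finset.sum_const, smul_eq_mul]
        ring

/-! ### Points and polynomials -/

section Incident

variable {F : Type} [Field F] {d : ℕ}

/-- The first coordinate of a common point determines it, and is a root of the nonzero difference of
the polynomials, whose degree is at most d. -/
theorem atMost_incident_inter (y y' : Fin (d + 1) → F) (h : y ≠ y') :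
    AtMost d fun x : F × F => Incident x y ∧ Incident x y' := by
  classical
  let p : Polynomial F := ∑ i : Fin (d + 1), Polynomial.C (y i - y' i) * Polynomial.X ^ (i : ℕ)
  have hcoeff : ∀ i : Fin (d + 1), p.coeff i = y i - y' i := by
    intro i
    simp only [p, Polynomial.finsetSum_coeff, Polynomial.coeff_C_mul, Polynomial.coeff_X_pow]
    rw [Finset.sum_eq_single i]
    · simp
    · intro j _ hj
      rw [if_neg (fun h => hj (Fin.ext h.symm)), mul_zero]
    · simp
  have hp : p ≠ 0 := by
    intro h0
    refine h (funext fun i => sub_eq_zero.1 ?_)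
    rw [← hcoeff, h0, Polynomial.coeff_zero]
  have hdeg : p.natDegree ≤ d := by
    refine Polynomial.natDegree_sum_le_of_forall_le _ _ fun i _ => ?_
    exact (Polynomial.natDegree_C_mul_X_pow_le _ _).trans (by omega)
  have hroots : AtMost d fun t : F => p.IsRoot t := by
    intro s hs
    calc s.card ≤ p.roots.toFinset.card := Finset.card_le_card fun t ht =>
          Multiset.mem_toFinset.2 ((Polynomial.mem_roots hp).2 (hs t ht))
      _ ≤ p.roots.card := Multiset.toFinset_card_le _
      _ ≤ d := (Polynomial.card_roots' p).trans hdeg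
  refine hroots.of_injOn Prod.fst ?_ ?_
  · rintro x ⟨h1, h2⟩
    rw [Incident] at h1 h2
    simp only [p, Polynomial.IsRoot, Polynomial.eval_finsetSum, Polynomial.eval_mul,
      Polynomial.eval_C, Polynomial.eval_pow, Polynomial.eval_X, sub_mul, Finset.sum_sub_distrib]
    rw [← h1, ← h2, sub_self]
  · rintro x x' ⟨h1, _⟩ ⟨h1', _⟩ h
    rw [Incident] at h1 h1'
    exact Prod.ext h (by rw [h1, h1', h])

theorem atMost_incident [Finite F] (x : F × F) :
    AtMost (Nat.card F ^ d) fun y : Fin (d + 1) → F => Incident x y := by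
  classical
  have := Fintype.ofFinite F
  have huniv : AtMost (Nat.card F ^ d) fun _ : Fin d → F => True := fun s _ =>
    s.card_le_univ.trans (by simp)
  refine huniv.of_injOn Fin.tail (fun _ _ => trivial) fun y y' h h' ht => ?_
  have hs : ∀ i : Fin d, y i.succ = y' i.succ := fun i => congrFun ht i
  rw [Incident, Fin.sum_univ_succ] at h h'
  simp only [hs] at h
  have h0 : y 0 = y' 0 := by simpa using h.symm.trans h'
  funext i
  exact Fin.cases h0 hs i

end Incident

namespace FieldCoding

theorem card_galoisField {n : ℕ} (hn : 1 ≤ n) : Nat.card (GaloisField 2 n) = 2 ^ n :=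
  GaloisField.card 2 n (by omega)

/-- An injection between sets of 2^n elements is onto. Hence codes of vertices are recognised by the
lengths of their strings alone. -/
theorem exists_enc_eq (K : FieldCoding) {n : ℕ} (hn : 1 ≤ n) (s : Str) (hs : s.length = n) :
    ∃ a, K.enc n a = s := by
  classical
  have : Finite (GaloisField 2 n) := Nat.finite_of_card_ne_zero (by
    rw [card_galoisField hn]; positivity)
  have := Fintype.ofFinite (GaloisField 2 n)
  let f : GaloisField 2 n → List.Vector Bool n := fun a => ⟨K.enc n a, K.enc_length n hn a⟩
  have hf : Function.Injective f := fun a b h => K.enc_injective n (congrArg Subtype.val h)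
  have hb : Function.Bijective f := (Fintype.bijective_iff_injective_and_card f).2 ⟨hf, by
    rw [← Nat.card_eq_fintype_card, card_galoisField hn, card_vector, Fintype.card_bool]⟩
  obtain ⟨a, ha⟩ := hb.2 ⟨s, hs⟩
  exact ⟨a, congrArg Subtype.val ha⟩

theorem exists_ofFn_eq {m : ℕ} (s : Str) (hs : s.length = m) : ∃ r : Fin m → Bool,
    List.ofFn r = s := by
  subst hs
  exact ⟨s.get, List.ofFn_get s⟩

theorem exists_poly_eq (K : FieldCoding) {n d : ℕ} (hn : 1 ≤ n) (l : List Str)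
    (hl : l.length = d + 1) (h : ∀ s ∈ l, s.length = n) : ∃ y : PolyUpTo n d, K.poly y = l := by
  have h' : ∀ i : Fin (d + 1), ∃ a, K.enc n a = l.get (i.cast hl.symm) :=
    fun i => K.exists_enc_eq hn _ (h _ (List.get_mem _ _))
  choose y hy using h'
  refine ⟨y, ?_⟩
  simp only [poly, hy]
  refine List.ext_get (by simp [hl]) fun i h1 h2 => by simp [-List.ofFn_succ]

theorem poly_length (K : FieldCoding) {n d : ℕ} (y : PolyUpTo n d) :
    (K.poly y).length = d + 1 := by
  simp [poly]

theorem length_of_mem_poly (K : FieldCoding) {n d : ℕ} (hn : 1 ≤ n) (y : PolyUpTo n d) :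
    ∀ s ∈ K.poly y, s.length = n := by
  intro s hs
  obtain ⟨i, rfl⟩ := List.mem_ofFn.1 hs
  exact K.enc_length n hn _

theorem left_injective (K : FieldCoding) {n m : ℕ} :
    Function.Injective (K.left : Point n × (Fin m → Bool) → _) := by
  rintro ⟨⟨a, b⟩, r⟩ ⟨⟨a', b'⟩, r'⟩ h
  simp only [left, point, Prod.mk.injEq] at h
  obtain ⟨⟨h1, h2⟩, h3⟩ := h
  rw [K.enc_injective n h1, K.enc_injective n h2, List.ofFn_injective h3]

theorem right_injective (K : FieldCoding) {n d m : ℕ} :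
    Function.Injective (K.right : PolyUpTo n d × (Fin m → Bool) → _) := by
  rintro ⟨y, r⟩ ⟨y', r'⟩ h
  simp only [right, poly, Prod.mk.injEq] at h
  have h1 := List.ofFn_injective h.1
  rw [List.ofFn_injective h.2, funext fun i => K.enc_injective n (congrFun h1 i)]

/-- Evaluation of polynomials, and hence incidence, is computable on codes. -/
theorem exists_eval (K : FieldCoding) : ∃ ev : ℕ × Str × List Str → Str, Computable ev ∧
    ∀ n, 1 ≤ n → ∀ (d : ℕ) (x : Point n) (y : PolyUpTo n d),
      ev (n, K.enc n x.1, K.poly y) = K.enc n x.2 ↔ Incident x y := by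
  obtain ⟨fa, hfa, hadd⟩ := K.add_computable
  obtain ⟨fm, hfm, hmul⟩ := K.mul_computable
  have hfa' : Computable fun x : ℕ × Str × Str => fa x.1 x.2 := hfa
  have hfm' : Computable fun x : ℕ × Str × Str => fm x.1 x.2 := hfm
  -- Horner's scheme, starting with the top coefficient. In characteristic 2 the sum of the argument
  -- with itself supplies the code of zero.
  let ho : ℕ × Str × List Str → ℕ → Str := fun x j => Nat.rec (fa x.1 (x.2.1, x.2.1))
    (fun i h => fa x.1 (fm x.1 (h, x.2.1), x.2.2.getD (x.2.2.length - 1 - i) [])) j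
  refine ⟨fun x => ho x x.2.2.length, ?_, fun n hn d x y => ?_⟩
  · refine Computable.nat_rec (f := fun x : ℕ × Str × List Str => x.2.2.length)
      (g := fun x => fa x.1 (x.2.1, x.2.1)) (h := fun x p => fa x.1 (fm x.1 (p.2, x.2.1),
        x.2.2.getD (x.2.2.length - 1 - p.1) [])) (by fun_prop) (by fun_prop) ?_
    refine Computable₂.mk ?_
    fun_prop
  · let Y : ℕ → GaloisField 2 n := fun i => if h : i < d + 1 then y ⟨i, h⟩ else 0
    have key : ∀ j ≤ d + 1, ho (n, K.enc n x.1, K.poly y) j =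
        K.enc n (∑ i ∈ Finset.range j, Y (d + 1 - j + i) * x.1 ^ i) := by
      intro j
      induction j with
      | zero =>
        intro _
        change fa n (K.enc n x.1, K.enc n x.1) = _
        rw [hadd n hn, CharTwo.add_self_eq_zero, Finset.sum_range_zero]
      | succ j ih =>
        intro hj
        change fa n (fm n (ho (n, K.enc n x.1, K.poly y) j, K.enc n x.1),
          (K.poly y).getD ((K.poly y).length - 1 - j) []) = _
        have hget : (K.poly y).getD ((K.poly y).length - 1 - j) [] = K.enc n (Y (d - j)) := by
          have hlt : d - j < d + 1 := by omega
          have hY : Y (d - j) = y ⟨d - j, hlt⟩ := dif_pos hlt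
          rw [hY, K.poly_length, Nat.add_sub_cancel]
          simp [poly, List.getD, hlt, -List.ofFn_succ]
        rw [ih (by omega), hmul n hn, hget, hadd n hn, Finset.sum_range_succ', Finset.sum_mul]
        congr 2
        · refine Finset.sum_congr rfl fun i _ => ?_
          have : d + 1 - (j + 1) + (i + 1) = d + 1 - j + i := by omega
          rw [this, pow_succ, mul_assoc]
        · simp
    change ho _ (K.poly y).length = _ ↔ _
    rw [K.poly_length, key (d + 1) le_rfl, (K.enc_injective n).eq_iff, Incident,
      Finset.sum_range, eq_comm]
    have : ∀ i : Fin (d + 1), Y (d + 1 - (d + 1) + i) = y i := fun i => by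
      simp only [Nat.sub_self, zero_add, Y]
      exact dif_pos i.2
    simp only [this]

end FieldCoding

/-! ### Transcripts -/

/-- The transcript `t` is complete, and the party `who` with the input `a` has followed the
protocol. -/
def IsSide {α : Type} (sp : Params → Str → Option Bool) (bit : Params → α × Str → Bool)
    (who : Bool) (π : Params) (a : α) (t : Str) : Prop :=
  sp π t = none ∧ ∀ i < t.length,
    (sp π (t.take i) = some who ∧ t[i]? = some (bit π (a, t.take i))) ∨
      sp π (t.take i) = some (!who)

/-- The condition splits into one on `a` and one on `b`: the inputs with transcript `t` form a
rectangle. -/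
theorem KeyProtocol.isTranscript_iff (P : KeyProtocol) (π : Params) (a : (Str × Str) × Str)
    (b : List Str × Str) (t : Str) :
    P.IsTranscript π a b t ↔
      IsSide P.speaker P.aliceBit true π a t ∧ IsSide P.speaker P.bobBit false π b t := by
  constructor
  · rintro ⟨h0, h⟩
    refine ⟨⟨h0, fun i hi => ?_⟩, h0, fun i hi => ?_⟩
    · rcases h ⟨i, hi⟩ with ⟨h1, h2⟩ | ⟨h1, -⟩
      · exact Or.inl ⟨h1, by simpa [hi] using h2⟩
      · exact Or.inr h1
    · rcases h ⟨i, hi⟩ with ⟨h1, -⟩ | ⟨h1, h2⟩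
      · exact Or.inr h1
      · exact Or.inl ⟨h1, by simpa [hi] using h2⟩
  · rintro ⟨⟨h0, ha⟩, -, hb⟩
    refine ⟨h0, fun i => ?_⟩
    rcases ha i i.2 with ⟨h1, h2⟩ | h1
    · exact Or.inl ⟨h1, by simpa using h2⟩
    · rcases hb i i.2 with ⟨-, h2⟩ | h2
      · exact Or.inr ⟨h1, by simpa using h2⟩
      · rw [h1] at h2
        simp at h2

section Side

variable {α β : Type} {sp : Params → Str → Option Bool} {bit : Params → α × Str → Bool}
  {who : Bool} {π : Params}

theorem IsSide.semi [Primcodable α] (hsp : Computable₂ sp) (hbit : Computable₂ bit) :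
    Semi fun x : (Params × α) × Str => IsSide sp bit who x.1.1 x.1.2 x.2 := by
  have hsp' : Computable fun x : Params × Str => sp x.1 x.2 := hsp
  have hbit' : Computable fun x : Params × α × Str => bit x.1 x.2 := hbit
  exact Semi.and (Semi.eq (by fun_prop) (by fun_prop)) (Semi.ball (by fun_prop)
    (Semi.or (Semi.and (Semi.eq (by fun_prop) (by fun_prop)) (Semi.eq (by fun_prop) (by fun_prop)))
      (Semi.eq (by fun_prop) (by fun_prop))))

theorem IsSide.ne_none {a : α} {t : Str} (h : IsSide sp bit who π a t) (i : ℕ) (hi : i < t.length) :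
    sp π (t.take i) ≠ none := by
  rcases h.2 i hi with ⟨h, -⟩ | h <;> simp [h]

/-- Two complete transcripts that never diverge coincide. -/
theorem transcript_unique {s : Str → Option Bool} {t t' : Str} (h : s t = none) (h' : s t' = none)
    (hn : ∀ i < t.length, s (t.take i) ≠ none) (hn' : ∀ i < t'.length, s (t'.take i) ≠ none)
    (hstep : ∀ i, i < t.length → i < t'.length → t.take i = t'.take i → t[i]? = t'[i]?) :
    t = t' := by
  have key : ∀ i, i ≤ t.length → i ≤ t'.length → t.take i = t'.take i := by
    intro i
    induction i with
    | zero => simp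
    | succ i ih =>
      intro hi hi'
      have e := ih (by omega) (by omega)
      rw [List.take_add_one, List.take_add_one, e, hstep i hi hi' e]
  rcases lt_trichotomy t.length t'.length with hl | hl | hl
  · have := key t.length le_rfl hl.le
    rw [List.take_length] at this
    exact absurd (this ▸ h) (hn' _ hl)
  · have := key t.length le_rfl hl.le
    rwa [List.take_length, hl, List.take_length] at this
  · have := key t'.length hl.le le_rfl
    rw [List.take_length] at this
    exact absurd (by rw [this]; exact h') (hn _ hl)

/-- Whoever speaks next, the two inputs and the bits so far fix the next bit. Thus the rectangles of
distinct transcripts are disjoint. -/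
theorem IsSide.unique {bit' : Params → β × Str → Bool} {a : α} {b : β} {t t' : Str}
    (ha : IsSide sp bit true π a t) (hb : IsSide sp bit' false π b t)
    (ha' : IsSide sp bit true π a t') (hb' : IsSide sp bit' false π b t') : t = t' := by
  refine transcript_unique ha.1 ha'.1 ha.ne_none ha'.ne_none fun i hi hi' e => ?_
  rcases ha.2 i hi with ⟨h1, h2⟩ | h1
  · rcases ha'.2 i hi' with ⟨-, h3⟩ | h3
    · rw [h2, h3, e]
    · rw [← e, h1] at h3
      simp at h3
  · rcases hb.2 i hi with ⟨-, h2⟩ | h2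
    · rcases hb'.2 i hi' with ⟨-, h3⟩ | h3
      · rw [h2, h3, e]
      · rw [← e, h1] at h3
        simp at h3
    · rw [h1] at h2
      simp at h2

/-- The bits written by the party `who` among the first `j` bits of `t`. -/
def sentBits (s : Str → Option Bool) (who : Bool) (t : Str) : ℕ → Str
  | 0 => []
  | j + 1 => bif decide (s (t.take j) = some who) then sentBits s who t j ++ [t.getD j false]
      else sentBits s who t j

theorem length_sentBits (s : Str → Option Bool) (who : Bool) (t : Str) (j : ℕ) :
    (sentBits s who t j).length =
      ((Finset.range j).filter fun i => s (t.take i) = some who).card := by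
  induction j with
  | zero => rfl
  | succ j ih =>
    rw [Finset.range_add_one, Finset.filter_insert, sentBits]
    by_cases h : s (t.take j) = some who
    · simp [h, ih]
    · simp [h, ih]

theorem sentBits_prefix (s : Str → Option Bool) (who : Bool) (t : Str) (j k : ℕ) :
    sentBits s who t j <+: sentBits s who t (j + k) := by
  induction k with
  | zero => exact List.prefix_rfl
  | succ k ih =>
    refine ih.trans ?_
    rw [← add_assoc, sentBits]
    cases decide (s (t.take (j + k)) = some who)
    · exact List.prefix_rfl
    · exact List.prefix_append _ _

theorem sentBits_congr (s : Str → Option Bool) (who : Bool) {t t' : Str} {j : ℕ}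
    (hj : j ≤ t.length) (hj' : j ≤ t'.length)
    (h : t.take j = t'.take j) : sentBits s who t j = sentBits s who t' j := by
  induction j with
  | zero => rfl
  | succ j ih =>
    have h0 : t.take j = t'.take j := by
      simpa [List.take_take] using congrArg (List.take j) h
    have h1 : t[j]? = t'[j]? := by
      have := congrArg (fun l : Str => l[j]?) h
      simpa [List.getElem?_take] using this
    rw [sentBits, sentBits, ih (by omega) (by omega) h0, h0, List.getD, List.getD, h1]

theorem computable_sentBits (hsp : Computable₂ sp) (who : Bool) :
    Computable fun x : Params × Str => sentBits (sp x.1) who x.2 x.2.length := by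
  have hsp' : Computable fun x : Params × Str => sp x.1 x.2 := hsp
  have hdec : Computable fun o : Option Bool => decide (o = some who) :=
    (Primrec.dom_finite _).to_comp
  have := Computable.nat_rec (f := fun x : Params × Str => x.2.length) (g := fun _ => ([] : Str))
    (h := fun x p => bif decide (sp x.1 (x.2.take p.1) = some who)
      then p.2 ++ [x.2.getD p.1 false] else p.2) (by fun_prop) (by fun_prop)
    (Computable₂.mk (Computable.cond (hdec.comp (by fun_prop)) (by fun_prop) (by fun_prop)))
  refine this.of_eq fun x => ?_
  generalize x.2.length = j
  induction j with
  | zero => rfl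
  | succ j ih => simp only [ih, sentBits]

/-- A transcript is determined by the input of one party and the bits sent by the other one. -/
theorem IsSide.eq_of_sentBits_eq {a : α} {t t' : Str} (h : IsSide sp bit who π a t)
    (h' : IsSide sp bit who π a t') (hs : sentBits (sp π) (!who) t t.length =
      sentBits (sp π) (!who) t' t'.length) : t = t' := by
  refine transcript_unique h.1 h'.1 h.ne_none h'.ne_none fun i hi hi' e => ?_
  rcases h.2 i hi with ⟨h1, h2⟩ | h1
  · rcases h'.2 i hi' with ⟨-, h3⟩ | h3
    · rw [h2, h3, e]
    · rw [← e, h1] at h3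
      simp at h3
  -- After a common prefix of `t` and `t'`, the next bit of the other party stands at the same place
  -- in the two strings of bits sent, and these are equal.
  · have step : ∀ {r : Str}, i < r.length → sp π (r.take i) = some (!who) →
        sentBits (sp π) (!who) r i ++ [r.getD i false] <+:
          sentBits (sp π) (!who) r r.length := by
      intro r hr hsp
      have := sentBits_prefix (sp π) (!who) r (i + 1) (r.length - (i + 1))
      rw [Nat.add_sub_cancel' hr, sentBits, decide_eq_true hsp] at this
      exact this
    have p := step hi h1
    have p' := step hi' (e ▸ h1)
    rw [← hs, ← sentBits_congr _ _ hi.le hi'.le e] at p'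
    have := List.prefix_of_prefix_length_le p p' (by simp)
    have := (List.prefix_append_right_inj _).1 this
    simp only [List.getD, hi, hi', List.getElem?_eq_getElem, Option.getD_some] at this ⊢
    simpa using this

end Side

theorem KeyProtocol.bitsSent_eq (P : KeyProtocol) (π : Params) (who : Bool) (t : Str) :
    P.bitsSent π who t = (sentBits (P.speaker π) who t t.length).length := by
  rw [length_sentBits, KeyProtocol.bitsSent, Finset.card_filter, Finset.card_filter,
    Finset.sum_range]

theorem atMost_length_eq (k : ℕ) : AtMost (2 ^ k) fun s : Str => s.length = k := by
  classical
  intro s hs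
  have huniv : AtMost (2 ^ k) fun _ : Fin k → Bool => True := fun s _ =>
    s.card_le_univ.trans (by simp)
  refine huniv.of_injOn (p := fun s : Str => s.length = k) (fun s i => s.getD i false)
    (fun _ _ => trivial) (fun s s' h h' e => ?_) s hs
  refine List.ext_getElem (h.trans h'.symm) fun i hi hi' => ?_
  simpa [List.getD, hi, hi'] using congrFun e ⟨i, h ▸ hi⟩

/-! ### Complexity of the transcript: bits sent and disjoint rectangles. -/

section Optimal

variable {α β : Type} [Primcodable α] [Primcodable β] {U : DescriptionMethod}
  {sp : Params → Str → Option Bool} {bit : Params → α × Str → Bool}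
  {bit' : Params → β × Str → Bool}

/-- The conditional complexity of the transcript given the input of one party does not exceed the
number of bits sent by the other one. -/
theorem IsOptimal.condC_transcript_le_sent (hU : IsOptimal U) (hsp : Computable₂ sp)
    (hbit : Computable₂ bit) (who : Bool) :
    ∃ c : ℕ, ∀ l : ℕ, 1 ≤ l → ∀ (π : Params) (a : α) (t : Str), encode π < 2 ^ (4 * l) →
      IsSide sp bit who π a t →
      (sentBits (sp π) (!who) t t.length).length < 2 ^ l →
      condC U t a ≤ (sentBits (sp π) (!who) t t.length).length + c * l := by
  have hs := computable_sentBits hsp (!who)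
  have hl : Computable fun x : Params × Str =>
    (sentBits (sp x.1) (!who) x.2 x.2.length).length := by fun_prop
  obtain ⟨c, hc⟩ := hU.condC_le_add_mul 8
    (R := fun (e : ℕ × Params) (a : α) (t : Str) => IsSide sp bit who e.2 a t ∧
      (sentBits (sp e.2) (!who) t t.length).length = e.1)
    (Semi.and ((IsSide.semi (who := who) hsp hbit).comp
      (f := fun x : ((ℕ × Params) × α) × Str => ((x.1.1.2, x.1.2), x.2)) (by fun_prop))
      (Semi.eq (hl.comp (g := fun x : ((ℕ × Params) × α) × Str => (x.1.1.2, x.2)) (by fun_prop))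
        (by fun_prop)))
  refine ⟨c, fun l hl π a t hπ h hlt => ?_⟩
  refine hc l hl _ (_, π) a t (encode_cons_lt 3 hlt hπ) ?_ ⟨h, rfl⟩
  exact (atMost_length_eq _).of_injOn (fun t => sentBits (sp π) (!who) t t.length)
    (fun _ h => h.2) fun t t' h h' e => h.1.eq_of_sentBits_eq h'.1 e

/-- The transcript reveals to an observer no less than to the two parties together. -/
theorem IsOptimal.plainC_transcript_le (hU : IsOptimal U) (hsp : Computable₂ sp)
    (hbit : Computable₂ bit) (hbit' : Computable₂ bit') :
    ∃ c : ℕ, ∀ l : ℕ, 1 ≤ l → ∀ (π : Params) (a : α) (b : β) (t : Str), encode π < 2 ^ (4 * l) →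
      IsSide sp bit true π a t → IsSide sp bit' false π b t →
      plainC U a < 2 ^ l → plainC U b < 2 ^ l →
      plainC U t + condC U a t + condC U b t ≤ plainC U a + plainC U b + c * l := by
  have hsa := IsSide.semi (who := true) hsp hbit
  have hsb := IsSide.semi (who := false) hsp hbit'
  obtain ⟨c₁, h₁⟩ := hU.condC_le_add_mul 8
    (R := fun (e : ℕ × Params) (t : Str) (a : α) => condC U a () ≤ e.1 ∧
      IsSide sp bit true e.2 a t)
    (Semi.and (hU.semi_condC_le (by fun_prop) (by fun_prop) (by fun_prop)) (hsa.comp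
      (f := fun x : ((ℕ × Params) × Str) × α => ((x.1.1.2, x.2), x.1.2)) (by fun_prop)))
  obtain ⟨c₂, h₂⟩ := hU.condC_le_add_mul 8
    (R := fun (e : ℕ × Params) (t : Str) (b : β) => condC U b () ≤ e.1 ∧
      IsSide sp bit' false e.2 b t)
    (Semi.and (hU.semi_condC_le (by fun_prop) (by fun_prop) (by fun_prop)) (hsb.comp
      (f := fun x : ((ℕ × Params) × Str) × β => ((x.1.1.2, x.2), x.1.2)) (by fun_prop)))
  obtain ⟨c₃, h₃⟩ := hU.condC_le_add_mul 128
    (R := fun (e : ℕ × ℕ × ℕ × ℕ × Params) (_ : Unit) (t : Str) =>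
      (∃ s : Finset α, s.card = 2 ^ e.1 ∧ ∀ a ∈ s, condC U a () ≤ e.2.1 ∧
        IsSide sp bit true e.2.2.2.2 a t) ∧
      ∃ s : Finset β, s.card = 2 ^ e.2.2.1 ∧ ∀ b ∈ s, condC U b () ≤ e.2.2.2.1 ∧
        IsSide sp bit' false e.2.2.2.2 b t)
    (Semi.and
      (Semi.many (by fun_prop) (Semi.and
        (hU.semi_condC_le (by fun_prop) (by fun_prop) (by fun_prop)) (hsa.comp
        (f := fun x : (((ℕ × ℕ × ℕ × ℕ × Params) × Unit) × Str) × α =>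
          ((x.1.1.1.2.2.2.2, x.2), x.1.2)) (by fun_prop))))
      (Semi.many (by fun_prop) (Semi.and
        (hU.semi_condC_le (by fun_prop) (by fun_prop) (by fun_prop)) (hsb.comp
        (f := fun x : (((ℕ × ℕ × ℕ × ℕ × Params) × Unit) × Str) × β =>
          ((x.1.1.1.2.2.2.2, x.2), x.1.2)) (by fun_prop)))))
  refine ⟨c₁ + c₂ + c₃ + 4, fun l hl π a b t hπ ha hb hka hkb => ?_⟩
  obtain ⟨ka, hka'⟩ : ∃ k, k = plainC U a := ⟨_, rfl⟩
  obtain ⟨kb, hkb'⟩ : ∃ k, k = plainC U b := ⟨_, rfl⟩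
  rw [← hka'] at hka
  rw [← hkb'] at hkb
  have hA : AtMost (2 ^ (ka + 1)) fun a' : α => condC U a' () ≤ ka ∧ IsSide sp bit true π a' t :=
    (hU.atMost () ka).mono fun _ h => h.1
  have hB : AtMost (2 ^ (kb + 1)) fun b' : β => condC U b' () ≤ kb ∧ IsSide sp bit' false π b' t :=
    (hU.atMost () kb).mono fun _ h => h.1
  -- 2^u and 2^v approximate the sides of the rectangle of `t` among inputs of complexity at most
  -- `ka`, `kb`. Given `t`, the inputs thus cost about u and v bits.
  obtain ⟨u, ⟨s, hs, hs'⟩, hu⟩ := hA.exists_log a ⟨hka'.ge, ha⟩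
  obtain ⟨v, ⟨r, hr, hr'⟩, hv⟩ := hB.exists_log b ⟨hkb'.ge, hb⟩
  have e₁ := h₁ l hl (u + 1) (ka, π) t a (encode_cons_lt 3 hka hπ) hu ⟨hka'.ge, ha⟩
  have e₂ := h₂ l hl (v + 1) (kb, π) t b (encode_cons_lt 3 hkb hπ) hv ⟨hkb'.ge, hb⟩
  have hu1 : u ≤ ka + 1 := by
    have := hA s hs'
    rw [hs] at this
    exact (Nat.pow_le_pow_iff_right (by norm_num)).1 this
  have hv1 : v ≤ kb + 1 := by
    have := hB r hr'
    rw [hr] at this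
    exact (Nat.pow_le_pow_iff_right (by norm_num)).1 this
  have hpow : ∀ {k}, k < 2 ^ l → k + 1 < 2 ^ (2 * l) := by
    intro k hk
    have h4 : 2 ^ 1 ≤ 2 ^ l := Nat.pow_le_pow_right (by norm_num) hl
    have : 2 ^ (2 * l) = 2 ^ l * 2 ^ l := by rw [← pow_add]; congr 1; omega
    nlinarith
  have hπ' : encode π < 2 ^ (4 * (2 * l)) :=
    hπ.trans_le (Nat.pow_le_pow_right (by norm_num) (by omega))
  have henc : encode (u, ka, v, kb, π) < 2 ^ (128 * l) := by
    have := encode_cons_lt 31 (lt_of_le_of_lt hu1 (hpow hka)) (encode_cons_lt 15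
      (Nat.lt_of_succ_lt (hpow hka)) (encode_cons_lt 7 (lt_of_le_of_lt hv1 (hpow hkb))
      (encode_cons_lt 3 (Nat.lt_of_succ_lt (hpow hkb)) hπ')))
    exact this.trans_le (Nat.pow_le_pow_right (by norm_num) (by omega))
  have e₃ := h₃ l hl (ka + 1 + (kb + 1) - (u + v)) (u, ka, v, kb, π) () t henc ?_
    ⟨⟨s, hs, hs'⟩, r, hr, hr'⟩
  · have e₄ : plainC U t ≤ ka + 1 + (kb + 1) - (u + v) + c₃ * l := e₃
    have : (c₁ + c₂ + c₃ + 4) * l = c₁ * l + c₂ * l + c₃ * l + 4 * l := by ring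
    omega
  -- The disjoint rectangles share at most 2^(ka+kb+2) pairs, so at most 2^(ka+kb+2-u-v) transcripts
  -- have rectangles with sides at least 2^u and 2^v.
  · have hpairs : AtMost (2 ^ (ka + 1 + (kb + 1))) fun x : Str × α × β =>
        (condC U x.2.1 () ≤ ka ∧ IsSide sp bit true π x.2.1 x.1) ∧
          condC U x.2.2 () ≤ kb ∧ IsSide sp bit' false π x.2.2 x.1 := by
      rw [pow_add]
      refine ((hU.atMost (α := α) () ka).sigma (q := fun _ b' => condC U b' () ≤ kb)
        fun _ _ => hU.atMost (α := β) () kb).of_injOn Prod.snd (fun x h => ⟨h.1.1, h.2.1⟩) ?_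
      rintro ⟨t₁, a₁, b₁⟩ ⟨t₂, a₂, b₂⟩ h h' e
      obtain ⟨rfl, rfl⟩ := Prod.mk.inj e
      obtain rfl : t₁ = t₂ := h.1.2.unique h.2.2 h'.1.2 h'.2.2
      rfl
    intro S hS
    have := hpairs.of_fibers (M := 2 ^ (u + v)) (q := fun t' (x : α × β) =>
      (condC U x.1 () ≤ ka ∧ IsSide sp bit true π x.1 t') ∧
          condC U x.2 () ≤ kb ∧ IsSide sp bit' false π x.2 t') S (fun t' ht' => by
      obtain ⟨⟨s₁, h1, h2⟩, s₂, h3, h4⟩ := hS t' ht'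
      refine ⟨s₁ ×ˢ s₂, ?_, fun x hx => ?_⟩
      · rw [Finset.card_product, h1, h3, pow_add]
      · obtain ⟨hx1, hx2⟩ := Finset.mem_product.1 hx
        exact ⟨h2 _ hx1, h4 _ hx2⟩)
    refine Nat.le_of_mul_le_mul_right (this.trans ?_) (Nat.two_pow_pos (u + v))
    rw [← pow_add]
    exact Nat.pow_le_pow_right (by norm_num) (by omega)

end Optimal

/-! ### Complexity of points and polynomials -/

section Optimal

variable {U : DescriptionMethod}

/-- A point on the graph of a polynomial is determined by its first coordinate. -/
theorem IsOptimal.condC_point_le (hU : IsOptimal U) (K : FieldCoding) :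
    ∃ c : ℕ, ∀ l : ℕ, 1 ≤ l → ∀ (n d : ℕ) (x : Point n) (y : PolyUpTo n d), 1 ≤ n → n < 2 ^ l →
      Incident x y → condC U (K.point x) (K.poly y) ≤ n + c * l := by
  obtain ⟨ev, hev, hiff⟩ := K.exists_eval
  obtain ⟨c, hc⟩ := hU.condC_le_add_mul 1
    (R := fun (n : ℕ) (y : List Str) (x : Str × Str) => x.1.length = n ∧ ev (n, x.1, y) = x.2)
    (Semi.and (Semi.eq (by fun_prop) (by fun_prop)) (Semi.eq (by fun_prop) (by fun_prop)))
  refine ⟨c, fun l hl n d x y hn hnl hxy => ?_⟩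
  refine hc l hl n n (K.poly y) (K.point x) (by simpa using hnl) ?_
    ⟨K.enc_length n hn _, (hiff n hn d x y).2 hxy⟩
  exact (atMost_length_eq n).of_injOn Prod.fst (fun _ h => h.1) fun x x' h h' e =>
    Prod.ext e (by rw [← h.2, ← h'.2, e])

/-- A polynomial through a given point is determined by its higher coefficients. -/
theorem IsOptimal.condC_poly_le (hU : IsOptimal U) (K : FieldCoding) :
    ∃ c : ℕ, ∀ l : ℕ, 1 ≤ l → ∀ (n d : ℕ) (x : Point n) (y : PolyUpTo n d), 1 ≤ n → n < 2 ^ l →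
      d < 2 ^ l → Incident x y → condC U (K.poly y) (K.point x) ≤ d * n + c * l := by
  obtain ⟨ev, hev, hiff⟩ := K.exists_eval
  obtain ⟨c, hc⟩ := hU.condC_le_add_mul 2
    (R := fun (e : ℕ × ℕ) (x : Str × Str) (y : List Str) => y.length = e.2 + 1 ∧
      (∀ s ∈ y, s.length = e.1) ∧ ev (e.1, x.1, y) = x.2)
    (Semi.and (Semi.eq (by fun_prop) (by fun_prop)) (Semi.and (Semi.list_forall (by fun_prop)
      (Semi.eq (by fun_prop) (by fun_prop))) (Semi.eq (by fun_prop) (by fun_prop))))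
  refine ⟨c, fun l hl n d x y hn hnl hdl hxy => ?_⟩
  refine hc l hl (d * n) (n, d) (K.point x) (K.poly y) (encode_nat₂_lt hnl hdl) ?_
    ⟨K.poly_length y, K.length_of_mem_poly hn y, (hiff n hn d x y).2 hxy⟩
  have : Finite (GaloisField 2 n) := Nat.finite_of_card_ne_zero (by
    rw [FieldCoding.card_galoisField hn]; positivity)
  have h := (atMost_incident (d := d) x).ex (B := 1) (q := fun y l => l = K.poly y)
    fun y _ => AtMost.one fun _ _ h h' => h.trans h'.symm
  rw [mul_one, FieldCoding.card_galoisField hn, ← pow_mul, mul_comm] at h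
  refine h.mono ?_
  rintro l ⟨h1, h2, h3⟩
  obtain ⟨y', rfl⟩ := K.exists_poly_eq hn l h1 h2
  exact ⟨y', (hiff n hn d x y').1 h3, rfl⟩

/-- An edge between two sets of vertices of small complexity is simple, by the mixing property
of the graph. -/
theorem IsOptimal.condC_edge_le (hU : IsOptimal U) (K : FieldCoding) {ω : Type} [Primcodable ω] :
    ∃ c : ℕ, ∀ l : ℕ, 1 ≤ l → ∀ (n d m : ℕ) (x : Point n × (Fin m → Bool))
      (y : PolyUpTo n d × (Fin m → Bool)) (w : ω), 1 ≤ n → n < 2 ^ l → d < 2 ^ l → m < 2 ^ l →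
      condC U (K.left x) w < 2 ^ l → condC U (K.right y) w < 2 ^ l → Incident x.1 y.1 →
      2 * condC U (K.left x, K.right y) w ≤ m + condC U (K.left x) w + condC U (K.right y) w +
        max (condC U (K.left x) w) (condC U (K.right y) w) + c * l := by
  classical
  obtain ⟨ev, hev, hiff⟩ := K.exists_eval
  obtain ⟨c, hc⟩ := hU.condC_le_add_mul 16
    (R := fun (e : ℕ × ℕ × ℕ × ℕ × ℕ) (w : ω) (v : ((Str × Str) × Str) × (List Str × Str)) =>
      condC U v.1 w ≤ e.1 ∧ condC U v.2 w ≤ e.2.1 ∧ v.1.1.1.length = e.2.2.1 ∧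
      v.1.1.2.length = e.2.2.1 ∧ v.1.2.length = e.2.2.2.2 ∧ v.2.1.length = e.2.2.2.1 + 1 ∧
      (∀ s ∈ v.2.1, s.length = e.2.2.1) ∧ v.2.2.length = e.2.2.2.2 ∧
      ev (e.2.2.1, v.1.1.1, v.2.1) = v.1.1.2)
    (Semi.and (hU.semi_condC_le (by fun_prop) (by fun_prop) (by fun_prop)) <|
      Semi.and (hU.semi_condC_le (by fun_prop) (by fun_prop) (by fun_prop)) <|
      Semi.and (Semi.eq (by fun_prop) (by fun_prop)) <|
      Semi.and (Semi.eq (by fun_prop) (by fun_prop)) <|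
      Semi.and (Semi.eq (by fun_prop) (by fun_prop)) <|
      Semi.and (Semi.eq (by fun_prop) (by fun_prop)) <|
      Semi.and (Semi.list_forall (by fun_prop) (Semi.eq (by fun_prop) (by fun_prop))) <|
      Semi.and (Semi.eq (by fun_prop) (by fun_prop)) (Semi.eq (by fun_prop) (by fun_prop)))
  refine ⟨2 * c + 5, fun l hl n d m x y w hn hnl hdl hml hal hbl hxy => ?_⟩
  obtain ⟨a, ha⟩ : ∃ a, a = condC U (K.left x) w := ⟨_, rfl⟩
  obtain ⟨b, hb⟩ : ∃ b, b = condC U (K.right y) w := ⟨_, rfl⟩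
  rw [← ha, ← hb]
  rw [← ha] at hal
  rw [← hb] at hbl
  have : Finite (GaloisField 2 n) := Nat.finite_of_card_ne_zero (by
    rw [FieldCoding.card_galoisField hn]; positivity)
  have := Fintype.ofFinite (GaloisField 2 n)
  let S : Finset (Point n × (Fin m → Bool)) :=
    Finset.univ.filter fun x => condC U (K.left x) w ≤ a
  let T : Finset (PolyUpTo n d × (Fin m → Bool)) :=
    Finset.univ.filter fun y => condC U (K.right y) w ≤ b
  let F := (S ×ˢ T).filter fun p => Incident p.1.1 p.2.1
  have hS : S.card ≤ 2 ^ (a + 1) :=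
    ((hU.atMost w a).of_injOn (p := fun x : Point n × (Fin m → Bool) =>
      condC U (K.left x) w ≤ a) K.left (fun _ h => h) fun _ _ _ _ e => K.left_injective e) S
      fun x hx => (Finset.mem_filter.1 hx).2
  have hT : T.card ≤ 2 ^ (b + 1) :=
    ((hU.atMost w b).of_injOn (p := fun y : PolyUpTo n d × (Fin m → Bool) =>
      condC U (K.right y) w ≤ b) K.right (fun _ h => h) fun _ _ _ _ e => K.right_injective e) T
      fun x hx => (Finset.mem_filter.1 hx).2
  -- Half the logarithm of the bound in `card_edges_sq_le`: `l` absorbs the factor d + 1, three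
  -- units come from the counts 2^(·+1), and one from rounding up.
  obtain ⟨k, hk⟩ : ∃ k, k = (m + a + b + max a b + l + 4) / 2 := ⟨_, rfl⟩
  have hF : F.card ≤ 2 ^ k := by
    have h1 := card_edges_sq_le (A := Fin m → Bool) (fun (x : Point n) (y : PolyUpTo n d) =>
      Incident x y) (fun y y' h => atMost_incident_inter y y' h) S T
    rw [Fintype.card_fun, Fintype.card_bool, Fintype.card_fin] at h1
    have h2 : S.card + d * T.card ≤ 2 ^ (l + (max a b + 1)) := by
      have hS' : S.card ≤ 2 ^ (max a b + 1) :=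
        hS.trans (Nat.pow_le_pow_right (by norm_num) (by omega))
      have hT' : T.card ≤ 2 ^ (max a b + 1) :=
        hT.trans (Nat.pow_le_pow_right (by norm_num) (by omega))
      calc S.card + d * T.card ≤ 2 ^ (max a b + 1) + d * 2 ^ (max a b + 1) :=
            Nat.add_le_add hS' (Nat.mul_le_mul_left _ hT')
        _ = (d + 1) * 2 ^ (max a b + 1) := by ring
        _ ≤ 2 ^ l * 2 ^ (max a b + 1) := Nat.mul_le_mul_right _ hdl
        _ = 2 ^ (l + (max a b + 1)) := (pow_add _ _ _).symm
    have h3 : F.card ^ 2 ≤ (2 ^ k) ^ 2 := by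
      calc F.card ^ 2 ≤ 2 ^ m * S.card * T.card * (S.card + d * T.card) := h1
        _ ≤ 2 ^ m * 2 ^ (a + 1) * 2 ^ (b + 1) * 2 ^ (l + (max a b + 1)) := by gcongr
        _ = 2 ^ (m + a + b + max a b + l + 3) := by
            simp only [← pow_add]; congr 1; omega
        _ ≤ (2 ^ k) ^ 2 := by
            rw [← pow_mul]; exact Nat.pow_le_pow_right (by norm_num) (by omega)
    exact (Nat.pow_le_pow_iff_left (by norm_num)).1 h3
  have key := hc l hl k (a, b, n, d, m) w (K.left x, K.right y)
    (encode_cons_lt 7 hal (encode_cons_lt 3 hbl (encode_cons_lt 1 hnl (encode_nat₂_lt hdl hml))))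
    ?_ ⟨ha.ge, hb.ge, K.enc_length n hn _, K.enc_length n hn _, by simp [FieldCoding.left],
      K.poly_length _, K.length_of_mem_poly hn _, by simp [FieldCoding.right],
      (hiff n hn d x.1 y.1).2 hxy⟩
  · have : (2 * c + 5) * l = 2 * (c * l) + 5 * l := by ring
    omega
  · intro s hs
    refine le_trans ?_ hF
    rw [← Finset.card_image_of_injective F (f := fun p => (K.left p.1, K.right p.2))
      fun p p' e => Prod.ext (K.left_injective (Prod.mk.inj e).1)
        (K.right_injective (Prod.mk.inj e).2)]
    refine Finset.card_le_card fun v hv => ?_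
    -- Every tuple enumerated is the code of an actual edge, because strings of the right lengths
    -- are codes.
    obtain ⟨⟨⟨x1, x2⟩, rx⟩, y0, ry⟩ := v
    obtain ⟨h1, h2, h3, h4, h5, h6, h7, h8, h9⟩ := hs _ hv
    simp only at h1 h2 h3 h4 h5 h6 h7 h8 h9
    obtain ⟨x1, rfl⟩ := K.exists_enc_eq hn x1 h3
    obtain ⟨x2, rfl⟩ := K.exists_enc_eq hn x2 h4
    obtain ⟨rx, rfl⟩ := FieldCoding.exists_ofFn_eq rx h5
    obtain ⟨ry, rfl⟩ := FieldCoding.exists_ofFn_eq ry h8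
    obtain ⟨y0, rfl⟩ := K.exists_poly_eq hn y0 h6 h7
    refine Finset.mem_image.2 ⟨(((x1, x2), rx), (y0, ry)), ?_, rfl⟩
    refine Finset.mem_filter.2 ⟨Finset.mem_product.2 ⟨Finset.mem_filter.2 ⟨Finset.mem_univ _, h1⟩,
      Finset.mem_filter.2 ⟨Finset.mem_univ _, h2⟩⟩, ?_⟩
    exact (hiff n hn d (x1, x2) y0).1 h9

/-- A string is not more complex than it is long. -/
theorem IsOptimal.condC_string_le (hU : IsOptimal U) {ω : Type} [Primcodable ω] :
    ∃ c : ℕ, ∀ l : ℕ, 1 ≤ l → ∀ (s : Str) (w : ω), s.length < 2 ^ l →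
      condC U s w ≤ s.length + c * l := by
  obtain ⟨c, hc⟩ := hU.condC_le_add_mul 1
    (R := fun (k : ℕ) (_ : ω) (s : Str) => s.length = k)
    (Semi.eq (by fun_prop) (by fun_prop))
  exact ⟨c, fun l hl s w hs => hc l hl _ _ w s (by simpa using hs) (atMost_length_eq _) rfl⟩

end Optimal

/-! ### Information inequalities for a key agreement -/

/-- A quantity known only up to `c * l` still has logarithm O(l), so estimates can be chained at the
cost of replacing `l` by a constant multiple. -/
theorem lt_two_pow_of_le_add_mul {p q c c' l : ℕ} (hl : 1 ≤ l) (hp : p < 2 ^ l)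
    (h : q ≤ p + c * l) (hc : c ≤ c') : q < 2 ^ ((c' + 1) * l) := by
  have h1 : c' + 1 ≤ 2 ^ c' := Nat.lt_two_pow_self
  have h2 : l < 2 ^ l := Nat.lt_two_pow_self
  calc q ≤ p + c * l := h
    _ < 2 ^ l + c' * 2 ^ l := by
      have : c * l ≤ c' * 2 ^ l := Nat.mul_le_mul hc h2.le
      omega
    _ = (c' + 1) * 2 ^ l := by ring
    _ ≤ 2 ^ c' * 2 ^ l := Nat.mul_le_mul_right _ h1
    _ = 2 ^ (c' + l) := (pow_add _ _ _).symm
    _ ≤ 2 ^ ((c' + 1) * l) := Nat.pow_le_pow_right (by norm_num) (by nlinarith)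

section Optimal

variable {α β : Type} [Primcodable α] [Primcodable β] {U : DescriptionMethod}
  {sp : Params → Str → Option Bool} {bit : Params → α × Str → Bool}
  {bit' : Params → β × Str → Bool} {key : Params → α × Str → Str} {key' : Params → β × Str → Str}

/-- Whatever is computed from the inputs, the key and the transcript is not more complex than the
pair of the inputs. -/
theorem IsOptimal.condC_le_plainC_inputs (hU : IsOptimal U) (hsp : Computable₂ sp)
    (hbit : Computable₂ bit) (hbit' : Computable₂ bit') (hkey : Computable₂ key) {δ : Type}
    [Primcodable δ] {f : Params × α × β × Str × Str → δ} (hf : Computable f) :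
    ∃ c : ℕ, ∀ l : ℕ, 1 ≤ l → ∀ (π : Params) (a : α) (b : β) (t z : Str),
      encode π < 2 ^ (4 * l) → IsSide sp bit true π a t → IsSide sp bit' false π b t →
      key π (a, t) = z → plainC U (a, b) < 2 ^ l →
      ∀ v : ℕ, condC U (f (π, a, b, z, t)) v ≤ plainC U (a, b) + c * l := by
  have hkey' : Computable fun x : Params × α × Str => key x.1 x.2 := hkey
  obtain ⟨c, hc⟩ := hU.condC_le_of_graph 4 (g := fun _ : Params × ℕ => ()) (Computable.const _)
    (G := fun (π : Params) (w : α × β) (v : δ) => ∃ t : Str, IsSide sp bit true π w.1 t ∧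
      IsSide sp bit' false π w.2 t ∧ v = f (π, w.1, w.2, key π (w.1, t), t))
    (Semi.ex (Semi.and ((IsSide.semi hsp hbit).comp
      (f := fun x : ((Params × α × β) × δ) × Str => ((x.1.1.1, x.1.1.2.1), x.2)) (by fun_prop))
      (Semi.and ((IsSide.semi hsp hbit').comp
      (f := fun x : ((Params × α × β) × δ) × Str => ((x.1.1.1, x.1.1.2.2), x.2)) (by fun_prop))
      (Semi.eq (by fun_prop) (by fun_prop))))) (by
        rintro π w v v' ⟨t, h1, h2, rfl⟩ ⟨t', h1', h2', rfl⟩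
        rw [h1.unique h2 h1' h2'])
  refine ⟨c, fun l hl π a b t z hπ ha hb hz hlt v => ?_⟩
  exact hc l hl π v (a, b) _ hπ hlt ⟨t, ha, hb, by rw [hz]⟩

/-- A party's input, given the transcript and the key computed from it. -/
theorem IsOptimal.condC_input_le (hU : IsOptimal U) (hkey : Computable₂ key) :
    ∃ c : ℕ, ∀ l : ℕ, 1 ≤ l → ∀ (π : Params) (a : α) (t z : Str),
      encode π < 2 ^ (4 * l) → key π (a, t) = z → plainC U a < 2 ^ l → condC U t a < 2 ^ l →
      plainC U t < 2 ^ l → condC U a t < 2 ^ l → plainC U (a, t) < 2 ^ l →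
      plainC U ((z, t), a) < 2 ^ l →
      plainC U (z, t) + condC U a (z, t) ≤ plainC U a + condC U t a + c * l ∧
      plainC U a + condC U t a ≤ plainC U t + condC U a t + c * l := by
  have hkey' : Computable fun x : Params × α × Str => key x.1 x.2 := hkey
  obtain ⟨c₁, h₁⟩ := hU.plainC_add_condC_le (α := Str × Str) (β := α)
  obtain ⟨c₂, h₂⟩ := hU.plainC_add_condC_le (α := α) (β := Str)
  obtain ⟨c₃, h₃⟩ := hU.condC_le_two_step 4 (ε := Params) (γ := Unit) (α := α) (β := Str)
    (g := fun x => x.2.2) (h := fun x => ((key x.1 (x.2.2.1, x.2.2.2), x.2.2.2), x.2.2.1))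
    (by fun_prop) (by fun_prop)
  obtain ⟨c₄, h₄⟩ := hU.condC_le_two_step 4 (ε := Params) (γ := Unit) (α := Str) (β := α)
    (g := fun x => x.2.2) (h := fun x => (x.2.2.2, x.2.2.1)) (by fun_prop) (by fun_prop)
  refine ⟨c₁ + c₂ + c₃ + c₄, fun l hl π a t z hπ hz ha hta ht hat hpat hpzta => ?_⟩
  have e₁ := h₁ l hl (z, t) a hpzta
  have e₂ := h₂ l hl a t hpat
  have e₃ := h₃ l hl π () a t hπ ha hta
  have e₄ := h₄ l hl π () t a hπ ht hat
  simp only [hz] at e₃ e₄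
  have e₃' : plainC U ((z, t), a) ≤ plainC U a + condC U t a + c₃ * l := e₃
  have e₄' : plainC U (a, t) ≤ plainC U t + condC U a t + c₄ * l := e₄
  have : (c₁ + c₂ + c₃ + c₄) * l = c₁ * l + c₂ * l + c₃ * l + c₄ * l := by ring
  constructor <;> omega

/-- What one party lacks about the other's input is covered by the transcript and by the
uncertainty that remains given the transcript and the key. -/
theorem IsOptimal.condC_other_le (hU : IsOptimal U) (hkey : Computable₂ key) :
    ∃ c : ℕ, ∀ l : ℕ, 1 ≤ l → ∀ (π : Params) (a : α) (b : β) (t z : Str),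
      encode π < 2 ^ (4 * l) → key π (a, t) = z → condC U t a < 2 ^ l →
      condC U b (z, t) < 2 ^ l → condC U b a ≤ condC U t a + condC U b (z, t) + c * l := by
  have hkey' : Computable fun x : Params × α × Str => key x.1 x.2 := hkey
  obtain ⟨c, h⟩ := hU.condC_le_two_step 4 (ε := Params) (γ := α) (α := Str) (β := β)
    (g := fun x => (key x.1 (x.2.1, x.2.2), x.2.2)) (h := fun x => x.2.2.2)
    (by fun_prop) (by fun_prop)
  refine ⟨c, fun l hl π a b t z hπ hz hta hbw => ?_⟩
  subst hz
  exact h l hl π a t b hπ hta hbw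

/-- The transcript has no complexity given both inputs. -/
theorem IsOptimal.condC_transcript_inputs_le (hU : IsOptimal U) (hsp : Computable₂ sp)
    (hbit : Computable₂ bit) (hbit' : Computable₂ bit') :
    ∃ c : ℕ, ∀ l : ℕ, 1 ≤ l → ∀ (π : Params) (a : α) (b : β) (t : Str),
      encode π < 2 ^ (4 * l) → IsSide sp bit true π a t → IsSide sp bit' false π b t →
      condC U t (a, b) ≤ c * l ∧ condC U t (b, a) ≤ c * l := by
  obtain ⟨c, hc⟩ := hU.condC_le_add_mul 4 (R := fun (π : Params) (w : α × β) (t : Str) =>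
      IsSide sp bit true π w.1 t ∧ IsSide sp bit' false π w.2 t)
    (Semi.and ((IsSide.semi hsp hbit).comp
      (f := fun x : (Params × α × β) × Str => ((x.1.1, x.1.2.1), x.2)) (by fun_prop))
      ((IsSide.semi hsp hbit').comp
      (f := fun x : (Params × α × β) × Str => ((x.1.1, x.1.2.2), x.2)) (by fun_prop)))
  obtain ⟨c', hc'⟩ := hU.condC_le_add_mul 4 (R := fun (π : Params) (w : β × α) (t : Str) =>
      IsSide sp bit true π w.2 t ∧ IsSide sp bit' false π w.1 t)
    (Semi.and ((IsSide.semi hsp hbit).comp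
      (f := fun x : (Params × β × α) × Str => ((x.1.1, x.1.2.2), x.2)) (by fun_prop))
      ((IsSide.semi hsp hbit').comp
      (f := fun x : (Params × β × α) × Str => ((x.1.1, x.1.2.1), x.2)) (by fun_prop)))
  refine ⟨c + c', fun l hl π a b t hπ ha hb => ?_⟩
  have e := hc l hl 0 π (a, b) t hπ
    (AtMost.one fun _ _ h h' => h.1.unique h.2 h'.1 h'.2) ⟨ha, hb⟩
  have e' := hc' l hl 0 π (b, a) t hπ
    (AtMost.one fun _ _ h h' => h.1.unique h.2 h'.1 h'.2) ⟨ha, hb⟩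
  have : (c + c') * l = c * l + c' * l := by ring
  constructor <;> omega

/-- The inequalities between complexities that hold in a key agreement, up to an error term. -/
structure KeyInequalities (U : DescriptionMethod) {α β : Type} [Primcodable α] [Primcodable β]
    (a : α) (b : β) (t z : Str) (err : ℕ) : Prop where
  secrecy : condC U a (z, t) + condC U b (z, t) + plainC U z + condC U t z + plainC U (a, b) ≤
    plainC U a + plainC U b + plainC U t + condC U (a, b) (z, t) + err
  right_le : condC U b a ≤ condC U t a + condC U b (z, t) + err
  left_le : condC U a b ≤ condC U t b + condC U a (z, t) + err
  transcript_le : condC U t (a, b) ≤ err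
  transcript_le' : condC U t (b, a) ≤ err
  left_bound : condC U a (z, t) ≤ plainC U (a, b) + err
  right_bound : condC U b (z, t) ≤ plainC U (a, b) + err
  le_pair : plainC U a + condC U b a ≤ plainC U (a, b) + err
  pair_le : plainC U (a, b) ≤ plainC U a + condC U b a + err
  pair_le' : plainC U (a, b) ≤ plainC U b + condC U a b + err

theorem IsOptimal.keyInequalities (hU : IsOptimal U) (hsp : Computable₂ sp)
    (hbit : Computable₂ bit) (hbit' : Computable₂ bit') (hkey : Computable₂ key)
    (hkey' : Computable₂ key') :
    ∃ c : ℕ, ∀ l : ℕ, 1 ≤ l → ∀ (π : Params) (a : α) (b : β) (t z : Str),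
      encode π < 2 ^ (4 * l) → IsSide sp bit true π a t → IsSide sp bit' false π b t →
      key π (a, t) = z → key' π (b, t) = z → plainC U (a, b) < 2 ^ l →
      KeyInequalities U a b t z (c * l) := by
  -- The lemmas combined here require complexities below a power of two. All the objects involved
  -- are computed from the inputs, so a single scale `r = (B + 1) * l` serves for all of them.
  have bound {δ : Type} [Primcodable δ] (f : Params × α × β × Str × Str → δ) (hf : Computable f) :=
    hU.condC_le_plainC_inputs hsp hbit hbit' hkey hf
  obtain ⟨b₁, hb₁⟩ := bound (fun x => x.2.1) (by fun_prop)
  obtain ⟨b₂, hb₂⟩ := bound (fun x => x.2.2.1) (by fun_prop)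
  obtain ⟨b₃, hb₃⟩ := bound (fun x => (x.2.1, x.2.2.1)) (by fun_prop)
  obtain ⟨b₄, hb₄⟩ := bound (fun x => x.2.2.2.2) (by fun_prop)
  obtain ⟨b₅, hb₅⟩ := bound (fun x => x.2.2.2) (by fun_prop)
  obtain ⟨b₆, hb₆⟩ := bound (fun x => (x.2.2.2, x.2.1)) (by fun_prop)
  obtain ⟨b₇, hb₇⟩ := bound (fun x => (x.2.2.2, x.2.2.1)) (by fun_prop)
  obtain ⟨b₈, hb₈⟩ := bound (fun x => (x.2.1, x.2.2.2.2)) (by fun_prop)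
  obtain ⟨b₉, hb₉⟩ := bound (fun x => (x.2.2.1, x.2.2.2.2)) (by fun_prop)
  obtain ⟨c₁, h₁⟩ := hU.condC_input_le (α := α) hkey
  obtain ⟨c₂, h₂⟩ := hU.condC_input_le (α := β) hkey'
  obtain ⟨c₃, h₃⟩ := hU.condC_other_le (α := α) (β := β) hkey
  obtain ⟨c₄, h₄⟩ := hU.condC_other_le (α := β) (β := α) hkey'
  obtain ⟨c₅, h₅⟩ := hU.condC_transcript_inputs_le hsp hbit hbit'
  obtain ⟨c₆, h₆⟩ := hU.plainC_transcript_le hsp hbit hbit'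
  obtain ⟨c₇, h₇⟩ := hU.plainC_add_condC_le (α := Str) (β := Str)
  obtain ⟨c₈, h₈⟩ := hU.plainC_add_condC_le (α := α) (β := β)
  obtain ⟨c₉, h₉⟩ := hU.condC_le_two_step 4 (ε := Params) (γ := Unit) (α := α) (β := β)
    (g := fun x => x.2.2) (h := fun x => (x.2.2.1, x.2.2.2)) (by fun_prop) (by fun_prop)
  obtain ⟨c₁₀, h₁₀⟩ := hU.condC_le_two_step 4 (ε := Params) (γ := Unit) (α := β) (β := α)
    (g := fun x => x.2.2) (h := fun x => (x.2.2.2, x.2.2.1)) (by fun_prop) (by fun_prop)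
  obtain ⟨c₁₁, h₁₁⟩ := hU.condC_le_two_step 4 (ε := Params) (γ := Unit) (α := Str × Str)
    (β := α × β) (g := fun x => x.2.2) (h := fun x => x.2.2.2) (by fun_prop) (by fun_prop)
  obtain ⟨B, hB⟩ : ∃ B, B = b₁ + b₂ + b₃ + b₄ + b₅ + b₆ + b₇ + b₈ + b₉ := ⟨_, rfl⟩
  refine ⟨(4 * (c₁ + c₂ + c₃ + c₄ + c₅ + c₆ + c₇ + c₈ + c₉ + c₁₀ + c₁₁)) * (B + 1) + B,
    fun l hl π a b t z hπ ha hb hz hz' hlt => ?_⟩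
  have lim {q c : ℕ} (h : q ≤ plainC U (a, b) + c * l) (hc : c ≤ B) : q < 2 ^ ((B + 1) * l) :=
    lt_two_pow_of_le_add_mul hl hlt h hc
  -- `condC` sees a condition only through its code, so the bound for numbers as conditions covers
  -- conditions of every type.
  have bd_a {γ : Type} [Primcodable γ] (v : γ) : condC U a v < 2 ^ ((B + 1) * l) :=
    lim (hb₁ l hl π a b t z hπ ha hb hz hlt (encode v)) (by omega)
  have bd_b {γ : Type} [Primcodable γ] (v : γ) : condC U b v < 2 ^ ((B + 1) * l) :=
    lim (hb₂ l hl π a b t z hπ ha hb hz hlt (encode v)) (by omega)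
  have bd_ab {γ : Type} [Primcodable γ] (v : γ) : condC U (a, b) v < 2 ^ ((B + 1) * l) :=
    lim (hb₃ l hl π a b t z hπ ha hb hz hlt (encode v)) (by omega)
  have bd_t {γ : Type} [Primcodable γ] (v : γ) : condC U t v < 2 ^ ((B + 1) * l) :=
    lim (hb₄ l hl π a b t z hπ ha hb hz hlt (encode v)) (by omega)
  have bd_w {γ : Type} [Primcodable γ] (v : γ) : condC U (z, t) v < 2 ^ ((B + 1) * l) :=
    lim (hb₅ l hl π a b t z hπ ha hb hz hlt (encode v)) (by omega)
  have bd_wa : plainC U ((z, t), a) < 2 ^ ((B + 1) * l) :=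
    lim (hb₆ l hl π a b t z hπ ha hb hz hlt (encode ())) (by omega)
  have bd_wb : plainC U ((z, t), b) < 2 ^ ((B + 1) * l) :=
    lim (hb₇ l hl π a b t z hπ ha hb hz hlt (encode ())) (by omega)
  have bd_at : plainC U (a, t) < 2 ^ ((B + 1) * l) :=
    lim (hb₈ l hl π a b t z hπ ha hb hz hlt (encode ())) (by omega)
  have bd_bt : plainC U (b, t) < 2 ^ ((B + 1) * l) :=
    lim (hb₉ l hl π a b t z hπ ha hb hz hlt (encode ())) (by omega)
  have left_bound : condC U a (z, t) ≤ plainC U (a, b) + b₁ * l :=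
    hb₁ l hl π a b t z hπ ha hb hz hlt (encode (z, t))
  have right_bound : condC U b (z, t) ≤ plainC U (a, b) + b₂ * l :=
    hb₂ l hl π a b t z hπ ha hb hz hlt (encode (z, t))
  have hbb : b₁ * l ≤ B * l ∧ b₂ * l ≤ B * l :=
    ⟨Nat.mul_le_mul_right _ (by omega), Nat.mul_le_mul_right _ (by omega)⟩
  obtain ⟨r, hr⟩ : ∃ r, r = (B + 1) * l := ⟨_, rfl⟩
  rw [← hr] at bd_wa bd_wb bd_at bd_bt
  simp only [← hr] at bd_a bd_b bd_ab bd_t bd_w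
  have hlr : l ≤ r := by rw [hr]; nlinarith
  have hr1 : 1 ≤ r := hl.trans hlr
  have hπr : encode π < 2 ^ (4 * r) :=
    hπ.trans_le (Nat.pow_le_pow_right (by norm_num) (by omega))
  have e₁ := h₁ r hr1 π a t z hπr hz (bd_a ()) (bd_t a) (bd_t ()) (bd_a t) bd_at bd_wa
  have e₂ := h₂ r hr1 π b t z hπr hz' (bd_b ()) (bd_t b) (bd_t ()) (bd_b t) bd_bt bd_wb
  have e₃ := h₃ r hr1 π a b t z hπr hz (bd_t a) (bd_b _)
  have e₄ := h₄ r hr1 π b a t z hπr hz' (bd_t b) (bd_a _)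
  have e₅ := h₅ r hr1 π a b t hπr ha hb
  have e₆ := h₆ r hr1 π a b t hπr ha hb (bd_a ()) (bd_b ())
  have e₇ := h₇ r hr1 z t (bd_w ())
  have e₈ := h₈ r hr1 a b (bd_ab ())
  have e₉ : plainC U (a, b) ≤ plainC U a + condC U b a + c₉ * r :=
    h₉ r hr1 π () a b hπr (bd_a ()) (bd_b a)
  have e₁₀ : plainC U (a, b) ≤ plainC U b + condC U a b + c₁₀ * r :=
    h₁₀ r hr1 π () b a hπr (bd_b ()) (bd_a b)
  have e₁₁ : plainC U (a, b) ≤ plainC U (z, t) + condC U (a, b) (z, t) + c₁₁ * r :=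
    h₁₁ r hr1 π () (z, t) (a, b) hπr (bd_w ()) (bd_ab _)
  obtain ⟨e₁, e₁'⟩ := e₁
  obtain ⟨e₂, e₂'⟩ := e₂
  obtain ⟨e₅, e₅'⟩ := e₅
  have hexp : ((4 * (c₁ + c₂ + c₃ + c₄ + c₅ + c₆ + c₇ + c₈ + c₉ + c₁₀ + c₁₁)) * (B + 1) + B) * l =
      4 * (c₁ * r + c₂ * r + c₃ * r + c₄ * r + c₅ * r + c₆ * r + c₇ * r + c₈ * r + c₉ * r +
        c₁₀ * r + c₁₁ * r) + B * l := by
    rw [hr]; ring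
  rw [hexp]
  have n₁ := Nat.zero_le (c₁ * r)
  have n₂ := Nat.zero_le (c₂ * r)
  have n₃ := Nat.zero_le (c₃ * r)
  have n₄ := Nat.zero_le (c₄ * r)
  have n₅ := Nat.zero_le (c₅ * r)
  have n₆ := Nat.zero_le (c₆ * r)
  have n₇ := Nat.zero_le (c₇ * r)
  have n₈ := Nat.zero_le (c₈ * r)
  have n₉ := Nat.zero_le (c₉ * r)
  have n₁₀ := Nat.zero_le (c₁₀ * r)
  have n₁₁ := Nat.zero_le (c₁₁ * r)
  have nB := Nat.zero_le (B * l)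
  clear hexp bd_wa bd_wb bd_at bd_bt hπr hr1 hlr hr hB hlt hπ hl
  -- For `secrecy`, `e₁` and `e₁'` give C(z,t) + C(a|z,t) ≤ C(t) + C(a|t), and `e₂`, `e₂'` the same
  -- for `b`. To their sum one adds the rectangle bound `e₆`; one C(z,t) is then bounded below by
  -- `e₇`, the other by `e₁₁`.
  constructor <;> linarith

end Optimal

/-! ### Key agreement on a typical edge -/

/-- The case analysis for the key agreement, in terms of the complexities involved: `a'`, `b'` and
`e'` are the complexities of the inputs and of the edge given the key and the transcript. -/
theorem key_agreement_cases {n dn m E cX cY cXY cYX cXY' cz ct ctz a' b' e' ctX ctY : ℤ}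
    (hX : |cX - (2 * n + m)| ≤ E) (hY : |cY - (dn + n + m)| ≤ E)
    (hXY : |cXY - (dn + 2 * n + 2 * m)| ≤ E) (hz : cz ≥ cY - cYX - E) (ht : ct - ctz ≤ E)
    (secrecy : a' + b' + cz + ctz + cXY ≤ cX + cY + ct + e' + E)
    (right_le : cYX ≤ ctX + b' + E) (left_le : cXY' ≤ ctY + a' + E)
    (le_pair : cX + cYX ≤ cXY + E) (pair_le : cXY ≤ cX + cYX + E)
    (pair_le' : cXY ≤ cY + cXY' + E) (edge : 2 * e' ≤ m + a' + b' + max a' b' + E) :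
    n + m - 3 * E ≤ cXY' ∧ dn + m - 3 * E ≤ cYX ∧
      (n - 25 * E ≤ ctY ∨ dn - 25 * E ≤ ctX) := by
  rw [abs_le] at hX hY hXY
  refine ⟨by linarith, by linarith, ?_⟩
  -- Secrecy and maximality of the key give a' + b' ≤ e' + O(E), so `edge` forces min(a', b') ≤ m +
  -- O(E). The party with the smaller value is the one that reveals everything.
  rcases le_total a' b' with h | h
  · rw [max_eq_right h] at edge
    left; linarith
  · rw [max_eq_left h] at edge
    right; linarith

section Optimal

variable {U : DescriptionMethod}

/-- The private random bits account for `m` bits of the complexity of an input. -/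
theorem IsOptimal.condC_amplified_le (hU : IsOptimal U) {α β : Type} [Primcodable α]
    [Primcodable β] :
    ∃ c : ℕ, ∀ l : ℕ, 1 ≤ l → ∀ (a : α) (b : β) (r r' : Str), condC U r (b, r') < 2 ^ l →
      condC U a b < 2 ^ l →
      condC U (a, r) (b, r') ≤ condC U r (b, r') + condC U a b + c * l := by
  obtain ⟨c, hc⟩ := hU.condC_le_two_step 1 (ε := Unit) (γ := β × Str) (α := Str) (β := α)
    (g := fun x => x.2.1.1) (h := fun x => (x.2.2.2, x.2.2.1)) (by fun_prop) (by fun_prop)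
  exact ⟨c, fun l hl a b r r' h1 h2 => hc l hl () (b, r') r a (by simp) h1 h2⟩

/-- Here `l` bounds the logarithms of all parameters and `E` dominates all errors. Typicality gives
C(a|b) ≥ n + m, of which the random bits account for at most m, hence C(x|y) ≥ n; the upper bound
holds since one coordinate determines a point of the graph of y. Likewise for C(y|x). -/
theorem IsOptimal.key_agreement (hU : IsOptimal U) (K : FieldCoding) (P : KeyProtocol) :
    ∃ J : ℕ, ∀ l : ℕ, 1 ≤ l → ∀ n d m : ℕ, 1 ≤ n → n < 2 ^ l → d < 2 ^ l → m < 2 ^ l →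
      d * n < 2 ^ l →
      ∀ (x : Point n) (rx : Fin m → Bool) (y : PolyUpTo n d) (ry : Fin m → Bool),
        plainC U (K.left (x, rx), K.right (y, ry)) < 2 ^ l → ∀ E : ℤ, J * l ≤ E →
        IsTypicalEdge U K E (x, rx) (y, ry) →
        ∀ t z : Str,
          P.AgreesOn (n, d, m) (K.left (x, rx)) (K.right (y, ry)) t z →
          (plainC U z : ℤ) ≥ mutInfo U (K.left (x, rx)) (K.right (y, ry)) - E →
          mutInfo U z t ≤ E →
          |(condC U (K.point x) (K.poly y) : ℤ) - n| ≤ 30 * E ∧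
          |(condC U (K.poly y) (K.point x) : ℤ) - d * n| ≤ 30 * E ∧
          ((condMutInfo U (K.left (x, rx)) t (K.right (y, ry)) ≥
                (condC U (K.point x) (K.poly y) : ℤ) - 30 * E ∧
              (P.bitsSent (n, d, m) true t : ℤ) ≥
                (condC U (K.point x) (K.poly y) : ℤ) - 30 * E) ∨
            (condMutInfo U (K.right (y, ry)) t (K.left (x, rx)) ≥
                (condC U (K.poly y) (K.point x) : ℤ) - 30 * E ∧
              (P.bitsSent (n, d, m) false t : ℤ) ≥
                (condC U (K.poly y) (K.point x) : ℤ) - 30 * E)) := by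
  obtain ⟨κ, hκ⟩ := hU.keyInequalities P.speaker_computable P.aliceBit_computable
    P.bobBit_computable P.aliceKey_computable P.bobKey_computable
  obtain ⟨c₁, h₁⟩ := hU.condC_point_le K
  obtain ⟨c₂, h₂⟩ := hU.condC_poly_le K
  obtain ⟨c₃, h₃⟩ := hU.condC_edge_le K (ω := Str × Str)
  obtain ⟨c₄, h₄⟩ := hU.condC_string_le (ω := List Str × Str)
  obtain ⟨c₅, h₅⟩ := hU.condC_string_le (ω := (Str × Str) × Str)
  obtain ⟨c₆, h₆⟩ := hU.condC_amplified_le (α := Str × Str) (β := List Str)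
  obtain ⟨c₇, h₇⟩ := hU.condC_amplified_le (α := List Str) (β := Str × Str)
  obtain ⟨c₈, h₈⟩ := hU.condC_transcript_le_sent P.speaker_computable P.aliceBit_computable true
  obtain ⟨c₉, h₉⟩ := hU.condC_transcript_le_sent P.speaker_computable P.bobBit_computable false
  obtain ⟨M, hM⟩ : ∃ M, M = κ + c₁ + c₂ + c₃ + c₄ + c₅ + c₆ + c₇ + c₈ + c₉ := ⟨_, rfl⟩
  refine ⟨M * (M + 1), fun l hl n d m hn hnl hdl hml hdnl x rx y ry hlt E hE hedge t z hag hz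
    hzt => ?_⟩
  obtain ⟨hinc, hX, hY, hXY⟩ := hedge
  obtain ⟨htr, hkA, hkB⟩ := hag
  obtain ⟨hA, hB⟩ := (P.isTranscript_iff _ _ _ _).1 htr
  have hinc' : Incident x y := hinc
  obtain ⟨r, hr⟩ : ∃ r, r = (M + 1) * l := ⟨_, rfl⟩
  have hlr : l ≤ r := by rw [hr]; nlinarith
  have hr1 : 1 ≤ r := hl.trans hlr
  have hpow : 2 ^ l ≤ 2 ^ r := Nat.pow_le_pow_right (by norm_num) hlr
  have hπ : encode ((n, d, m) : Params) < 2 ^ (4 * l) := encode_nat₃_lt hnl hdl hml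
  have hπr : encode ((n, d, m) : Params) < 2 ^ (4 * r) :=
    hπ.trans_le (Nat.pow_le_pow_right (by norm_num) (by omega))
  have err {c : ℕ} (hc : c ≤ M) : ((c * r : ℕ) : ℤ) ≤ E := by
    refine le_trans ?_ hE
    have : c * r ≤ M * (M + 1) * l := by
      rw [hr, ← mul_assoc]
      exact Nat.mul_le_mul_right _ (Nat.mul_le_mul_right _ hc)
    exact_mod_cast this
  have err' {c : ℕ} (hc : c ≤ M) : ((c * l : ℕ) : ℤ) ≤ E :=
    le_trans (by exact_mod_cast Nat.mul_le_mul_left c hlr) (err hc)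
  have hE0 : 0 ≤ E := le_trans (Int.natCast_nonneg _) (err (Nat.zero_le M))
  have I := hκ l hl (n, d, m) (K.left (x, rx)) (K.right (y, ry)) t z hπ hA hB hkA hkB hlt
  have e₁ := h₁ l hl n d x y hn hnl hinc'
  have e₂ := h₂ l hl n d x y hn hnl hdl hinc'
  have e₃ := h₃ r hr1 n d m (x, rx) (y, ry) (z, t) hn (hnl.trans_le hpow) (hdl.trans_le hpow)
    (hml.trans_le hpow)
    (by rw [hr]; exact lt_two_pow_of_le_add_mul hl hlt I.left_bound (by omega))
    (by rw [hr]; exact lt_two_pow_of_le_add_mul hl hlt I.right_bound (by omega)) hinc'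
  have e₄ := h₄ l hl (List.ofFn rx) (K.right (y, ry)) (by simpa using hml)
  have e₅ := h₅ l hl (List.ofFn ry) (K.left (x, rx)) (by simpa using hml)
  rw [List.length_ofFn] at e₄ e₅
  have e₆ : condC U (K.left (x, rx)) (K.right (y, ry)) ≤
      condC U (List.ofFn rx) (K.right (y, ry)) + condC U (K.point x) (K.poly y) + c₆ * r :=
    h₆ r hr1 (K.point x) (K.poly y) (List.ofFn rx) (List.ofFn ry)
      (by rw [hr]; exact lt_two_pow_of_le_add_mul hl hml e₄ (by omega))
      (by rw [hr]; exact lt_two_pow_of_le_add_mul hl hnl e₁ (by omega))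
  have e₇ : condC U (K.right (y, ry)) (K.left (x, rx)) ≤
      condC U (List.ofFn ry) (K.left (x, rx)) + condC U (K.poly y) (K.point x) + c₇ * r :=
    h₇ r hr1 (K.poly y) (K.point x) (List.ofFn ry) (List.ofFn rx)
      (by rw [hr]; exact lt_two_pow_of_le_add_mul hl hml e₅ (by omega))
      (by rw [hr]; exact lt_two_pow_of_le_add_mul hl hdnl e₂ (by omega))
  -- The comparison with the number of bits sent needs that number to be below 2^r. If it is not, it
  -- already exceeds the required bound.
  have e₈ : condC U t (K.left (x, rx)) ≤ P.bitsSent (n, d, m) false t + c₈ * r ∨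
      d * n ≤ P.bitsSent (n, d, m) false t := by
    rw [or_iff_not_imp_right, not_le, P.bitsSent_eq]
    exact fun h => h₈ r hr1 (n, d, m) _ t hπr hA ((h.trans hdnl).trans_le hpow)
  have e₉ : condC U t (K.right (y, ry)) ≤ P.bitsSent (n, d, m) true t + c₉ * r ∨
      n ≤ P.bitsSent (n, d, m) true t := by
    rw [or_iff_not_imp_right, not_le, P.bitsSent_eq]
    exact fun h => h₉ r hr1 (n, d, m) _ t hπr hB ((h.trans hnl).trans_le hpow)
  have wκ := err' (c := κ) (by omega)
  have w₁ := err' (c := c₁) (by omega)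
  have w₂ := err' (c := c₂) (by omega)
  have w₃ := err (c := c₃) (by omega)
  have w₄ := err' (c := c₄) (by omega)
  have w₅ := err' (c := c₅) (by omega)
  have w₆ := err (c := c₆) (by omega)
  have w₇ := err (c := c₇) (by omega)
  have w₈ := err (c := c₈) (by omega)
  have w₉ := err (c := c₉) (by omega)
  obtain ⟨i₁, i₂, i₃, i₄, i₅, -, -, i₆, i₇, i₈⟩ := I
  rw [mutInfo] at hz hzt
  rw [condMutInfo, condMutInfo]
  zify at e₁ e₂ e₃ e₄ e₅ e₆ e₇ e₈ e₉ i₁ i₂ i₃ i₄ i₅ i₆ i₇ i₈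
  push_cast at wκ w₁ w₂ w₃ w₄ w₅ w₆ w₇ w₈ w₉
  obtain ⟨f₁, f₂, f₃⟩ := key_agreement_cases (dn := d * n) (E := E) hX (by convert hY using 3; ring)
    (by convert hXY using 3; ring) hz hzt (i₁.trans (add_le_add le_rfl wκ))
    (i₂.trans (add_le_add le_rfl wκ)) (i₃.trans (add_le_add le_rfl wκ))
    (i₆.trans (add_le_add le_rfl wκ)) (i₇.trans (add_le_add le_rfl wκ))
    (i₈.trans (add_le_add le_rfl wκ)) (e₃.trans (add_le_add le_rfl w₃))
  refine ⟨abs_le.2 ⟨by linarith, by linarith⟩, abs_le.2 ⟨by linarith, by linarith⟩, ?_⟩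
  rcases f₃ with f₃ | f₃
  · refine Or.inl ⟨by linarith, ?_⟩
    rcases e₉ with e₉ | e₉ <;> linarith
  · refine Or.inr ⟨by linarith, ?_⟩
    rcases e₈ with e₈ | e₈ <;> linarith

end Optimal

theorem theorem5 (U : DescriptionMethod) (hU : IsOptimal U) (K : FieldCoding) (P : KeyProtocol)
    (c : ℕ) :
    ∃ c' : ℕ, ∀ n d m N : ℕ, 1 ≤ n → (2 * n + m) + ((d + 1) * n + m) ≤ N →
      ∀ (x : Point n) (rx : Fin m → Bool) (y : PolyUpTo n d) (ry : Fin m → Bool),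
        IsTypicalEdge U K (c * Nat.log 2 N) (x, rx) (y, ry) →
        ∀ t z : Str,
          P.AgreesOn (n, d, m) (K.left (x, rx)) (K.right (y, ry)) t z →
          (plainC U z : ℤ) ≥ mutInfo U (K.left (x, rx)) (K.right (y, ry)) - c * Nat.log 2 N →
          mutInfo U z t ≤ c * Nat.log 2 N →
          |(condC U (K.point x) (K.poly y) : ℤ) - n| ≤ c' * Nat.log 2 N ∧
          |(condC U (K.poly y) (K.point x) : ℤ) - d * n| ≤ c' * Nat.log 2 N ∧
          ((condMutInfo U (K.left (x, rx)) t (K.right (y, ry)) ≥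
                (condC U (K.point x) (K.poly y) : ℤ) - c' * Nat.log 2 N ∧
              (P.bitsSent (n, d, m) true t : ℤ) ≥
                (condC U (K.point x) (K.poly y) : ℤ) - c' * Nat.log 2 N) ∨
            (condMutInfo U (K.right (y, ry)) t (K.left (x, rx)) ≥
                (condC U (K.poly y) (K.point x) : ℤ) - c' * Nat.log 2 N ∧
              (P.bitsSent (n, d, m) false t : ℤ) ≥
                (condC U (K.poly y) (K.point x) : ℤ) - c' * Nat.log 2 N)) := by
  obtain ⟨J, hJ⟩ := hU.key_agreement K P
  -- This is 30 times the coefficient of L in E = 2(J + 1)(c + 1)L, where L is the logarithm of N.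
  -- The scale l = (c + 1)(L + 1) makes 2^l exceed (c + 1)N, a bound for the complexity of the edge,
  -- and L + 1 ≤ 2L accounts for the factor 2.
  refine ⟨60 * (J + 1) * (c + 1), fun n d m N hn hN x rx y ry hedge t z hag hz hzt => ?_⟩
  have hdn : d ≤ d * n := Nat.le_mul_of_pos_right d hn
  have hN' : 3 * n + 2 * m + d * n ≤ N := by linarith
  have hL : 1 ≤ Nat.log 2 N := Nat.log_pos (by norm_num) (by omega)
  obtain ⟨L, hLdef⟩ : ∃ L, L = Nat.log 2 N := ⟨_, rfl⟩
  have hNL : N < 2 ^ (L + 1) := hLdef ▸ Nat.lt_pow_succ_log_self (by norm_num) N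
  have hLN : L ≤ N := hLdef ▸ Nat.log_le_self 2 N
  rw [← hLdef] at hedge hz hzt hL ⊢
  have hl : 1 ≤ (c + 1) * (L + 1) := Nat.mul_pos (by omega) (by omega)
  have hpow : (c + 1) * N < 2 ^ ((c + 1) * (L + 1)) := by
    calc (c + 1) * N < (c + 1) * 2 ^ (L + 1) := Nat.mul_lt_mul_of_pos_left hNL (by omega)
      _ ≤ 2 ^ c * 2 ^ (L + 1) := Nat.mul_le_mul_right _ Nat.lt_two_pow_self
      _ = 2 ^ (c + (L + 1)) := (pow_add _ _ _).symm
      _ ≤ 2 ^ ((c + 1) * (L + 1)) := Nat.pow_le_pow_right (by norm_num) (by nlinarith)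
  have hNpow : N < 2 ^ ((c + 1) * (L + 1)) := lt_of_le_of_lt (by nlinarith) hpow
  have hplain : plainC U (K.left (x, rx), K.right (y, ry)) < 2 ^ ((c + 1) * (L + 1)) := by
    refine lt_of_le_of_lt ?_ hpow
    have h := (abs_le.1 hedge.2.2.2).2
    have hcL : (c * L : ℤ) ≤ c * N := by exact_mod_cast Nat.mul_le_mul_left c hLN
    zify at hN' ⊢
    nlinarith
  have hE : (c * L : ℤ) ≤ 2 * (J + 1) * (c + 1) * L := by
    have : c * L ≤ 2 * (J + 1) * (c + 1) * L := Nat.mul_le_mul_right _ (by nlinarith)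
    exact_mod_cast this
  have hJE : ((J : ℤ) * ((c + 1) * (L + 1) : ℕ)) ≤ 2 * (J + 1) * (c + 1) * L := by
    have : J * ((c + 1) * (L + 1)) ≤ 2 * (J + 1) * (c + 1) * L := by
      calc J * ((c + 1) * (L + 1)) ≤ (J + 1) * ((c + 1) * (2 * L)) :=
            Nat.mul_le_mul (by omega) (Nat.mul_le_mul_left _ (by omega))
        _ = _ := by ring
    exact_mod_cast this
  have key := hJ ((c + 1) * (L + 1)) hl n d m hn (by omega) (by omega) (by omega) (by omega)
    x rx y ry hplain _ hJE ⟨hedge.1, hedge.2.1.trans hE, hedge.2.2.1.trans hE,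
      hedge.2.2.2.trans hE⟩ t z hag (by linarith) (by linarith)
  have hc' : ((60 * (J + 1) * (c + 1) : ℕ) : ℤ) * L = 30 * (2 * (J + 1) * (c + 1) * L) := by
    push_cast
    ring
  rw [hc']
  exact key
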